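/- Let $\rho$ be a density matrix on $\mathbb C^2\otimes\mathbb C^4$ (positive semidefinite, trace one) of rank $2$. Conventions. A skew-conjugation is an anti-unitary operator $\Theta$ with $\Theta^2=-\mathbf 1$; the tensor product of skew-conjugations $\Theta_A$ on $\mathbb C^2$ and $\Theta_B$ on $\mathbb C^4$ is the conjugation $\Theta_A\otimes\Theta_B$ extending $|x\rangle\otimes|y\rangle\mapsto \Theta_A|x\rangle\otimes\Theta_B|y\rangle$ anti-linearly. For a conjugation $\Theta$, the generalized concurrence is $C_\Theta(\rho)=\min\sum_j\mu_j\,|\langle\psi_j|\Theta\psi_j\rangle|$, the minimum being over all finite decompositions $\rho=\sum_j\mu_j|\psi_j\rangle\langle\psi_j|$ into unit vectors with $\mu_j>0$, $\sum_j\mu_j=1$. Call $\rho$ a ZC-state if $C_{\Theta_A\otimes\Theta_B}(\rho)=0$ for all skew-conjugations $\Theta_A,\Theta_B$. The state $\rho$ is separable if it is a finite convex combination of matrices $|a\rangle\langle a|\otimes|b\rangle\langle b|$ with unit vectors $a,b$, and entangled otherwise; it is PPT if its partial transpose $\rho^{T_A}$ is positive semidefinite. A vector is separable if it is a product vector. Write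 $|a_1\rangle,|a_2\rangle$ and $|b_1\rangle,\dots,|b_4\rangle$ for the standard bases of $\mathbb C^2$ and $\mathbb C^4$. A matrix $\sigma$ is in canonical form if $\sigma=\lambda|\psi_1\rangle\langle\psi_1|+(1-\lambda)|\psi_2\rangle\langle\psi_2|$ with $0<\lambda<1$ and orthonormal $\psi_1,\psi_2$ such that $\psi_1=q_1|a_1b_1\rangle+q_6|a_2b_2\rangle$ with $q_1,q_6>0$, and $\psi_2=\sum_{k=1}^4 \left(p_k|a_1b_k\rangle+p_{4+k}|a_2b_k\rangle\right)$ with $p_1\ge 0\ge p_6$ real, $p_4=0$ and $p_1q_1+p_6q_6=0$. Up to local transformations means: after replacing $\rho$ by $(X_1\otimes X_2)\rho(X_1^\dagger\otimes X_2^\dagger)$ for some $X_1\in SU(2)$, $X_2\in SU(4)$. Theorem. $\rho$ is a ZC-state if and only if it belongs to one of the following two classes. 1. ZCS: either $\rho=\lambda|\psi_1\rangle\langle\psi_1|+(1-\lambda)|\psi_2\rangle\langle\psi_2|$ with $0<\lambda<1$ and orthonormal product vectors $\psi_1,\psi_2$; or $\rho$ is PPT and, up to local transformations, it is in canonical form and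 has the $2\times2$-block form $$\begin{pmatrix}\rho_{11}&0&\rho_{12}&0\\0&0&0&0\\ \rho_{12}^\dagger&0&\rho_{22}&0\\0&0&0&0\end{pmatrix},$$ where $\begin{pmatrix}\rho_{11}&\rho_{12}\\ \rho_{12}^\dagger&\rho_{22}\end{pmatrix}$ is separable as a two-qubit state. 2. ZCE: up to local transformations, $\rho$ is in canonical form with $\lambda=\tfrac12$, $\psi_1=q_1|a_1b_1\rangle+q_6|a_2b_2\rangle$ and $\psi_2=q_1|a_1b_3\rangle+q_6e^{i\phi}|a_2b_4\rangle$ for some $\phi\in\mathbb R$. The two classes are disjoint, every ZCS state is separable and every ZCE state is entangled. In particular there are entangled $2\times4$ states of rank $2$ all of whose generalized concurrences $C_{\Theta_A\otimes\Theta_B}$ vanish. -/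

import Mathlib

open scoped Matrix Kronecker BigOperators ComplexOrder

noncomputable section

namespace Concurrence

/-- The Hilbert space `ℂ^ι` with its standard inner product; `Ket (m × n)` is `ℂ^m ⊗ ℂ^n`
in coordinates with respect to the product basis. -/
abbrev Ket (ι : Type*) : Type _ := EuclideanSpace ℂ ι

/-- Anti-linear operators on `ℂ^ι`. -/
abbrev AntiLin (ι : Type*) : Type _ := Ket ι →ₛₗ[starRingEnd ℂ] Ket ι

/-- The product vector `|x⟩ ⊗ |y⟩`. -/
def prodKet {m n : Type*} (x : Ket m) (y : Ket n) : Ket (m × n) :=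
  WithLp.toLp 2 (fun p => x p.1 * y p.2)

/-- The rank-one matrix `|ψ⟩⟨ψ|`. -/
def ketBra {ι : Type*} (ψ : Ket ι) : Matrix ι ι ℂ :=
  Matrix.of (fun i j => ψ i * star (ψ j))

/-- Density matrices: positive semidefinite of trace one. -/
structure IsState {ι : Type*} [Fintype ι] (ρ : Matrix ι ι ℂ) : Prop where
  posSemidef : ρ.PosSemidef
  trace_eq_one : ρ.trace = 1

/-- `ρ = ∑ⱼ μⱼ |aⱼ⟩⟨aⱼ| ⊗ |bⱼ⟩⟨bⱼ|` with `μⱼ > 0`, `∑ⱼ μⱼ = 1` and unit vectors `aⱼ`, `bⱼ`. -/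
def IsSeparable {m n : Type*} [Fintype m] [Fintype n]
    (ρ : Matrix (m × n) (m × n) ℂ) : Prop :=
  ∃ (N : ℕ) (μ : Fin N → ℝ) (a : Fin N → Ket m) (b : Fin N → Ket n),
    (∀ j, 0 < μ j) ∧ ∑ j, μ j = 1 ∧ (∀ j, ‖a j‖ = 1) ∧ (∀ j, ‖b j‖ = 1) ∧
    ρ = ∑ j, (μ j : ℂ) • (ketBra (a j) ⊗ₖ ketBra (b j))

/-- A vector of `ℂ^m ⊗ ℂ^n` is separable if it is a product vector. -/
def IsProductKet {m n : Type*} (ψ : Ket (m × n)) : Prop :=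
  ∃ (a : Ket m) (b : Ket n), ψ = prodKet a b

/-- Partial transposition on the first factor: `(σ ⊗ S)^{T_A} = σᵀ ⊗ S`, extended linearly. -/
def partialTranspose {m n : Type*} (ρ : Matrix (m × n) (m × n) ℂ) : Matrix (m × n) (m × n) ℂ :=
  Matrix.of (fun p q => ρ (q.1, p.2) (p.1, q.2))

/-- `partialTranspose` on elementary tensors. -/
theorem partialTranspose_kronecker {m n : Type*} (σ : Matrix m m ℂ) (S : Matrix n n ℂ) :
    partialTranspose (σ ⊗ₖ S) = σᵀ ⊗ₖ S := by
  ext p q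
  simp [partialTranspose]

/-- States with positive partial transpose. -/
def IsPPT {m n : Type*} [Fintype m] [Fintype n] (ρ : Matrix (m × n) (m × n) ℂ) : Prop :=
  (partialTranspose ρ).PosSemidef

/-- A skew-conjugation: an anti-unitary operator with `Θ² = -1`. -/
structure IsSkewConjugation {ι : Type*} [Fintype ι] (Θ : AntiLin ι) : Prop where
  antiunitary : ∀ x y : Ket ι, inner ℂ (Θ x) (Θ y) = starRingEnd ℂ (inner ℂ x y)
  sq_eq_neg : ∀ x : Ket ι, Θ (Θ x) = -x

/-- A conjugation: an anti-unitary operator with `Θ² = 1`. -/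
structure IsConjugation {ι : Type*} [Fintype ι] (Θ : AntiLin ι) : Prop where
  antiunitary : ∀ x y : Ket ι, inner ℂ (Θ x) (Θ y) = starRingEnd ℂ (inner ℂ x y)
  sq_eq : ∀ x : Ket ι, Θ (Θ x) = x

/-- The tensor product of two anti-linear operators: the anti-linear extension of
`|i⟩ ⊗ |j⟩ ↦ Θ_A|i⟩ ⊗ Θ_B|j⟩`. -/
def antiTensor {m n : Type*} [Fintype m] [Fintype n] [DecidableEq m] [DecidableEq n]
    (ΘA : AntiLin m) (ΘB : AntiLin n) : AntiLin (m × n) where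
  toFun ψ := ∑ i, ∑ j, starRingEnd ℂ (ψ (i, j)) •
    prodKet (ΘA (EuclideanSpace.single i 1)) (ΘB (EuclideanSpace.single j 1))
  map_add' x y := by
    simp [add_smul, Finset.sum_add_distrib]
  map_smul' c x := by
    simp [mul_smul, Finset.smul_sum]

/-- Anti-linear operators in coordinates. -/
theorem antiLin_apply {m : Type*} [Fintype m] [DecidableEq m] (Θ : AntiLin m) (x : Ket m) :
    Θ x = ∑ i, starRingEnd ℂ (x i) • Θ (EuclideanSpace.single i 1) := by
  have h : x = ∑ i, x i • EuclideanSpace.single i (1 : ℂ) := by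
    ext k
    simp [Pi.single_apply]
  conv_lhs => rw [h]
  simp only [map_sum, map_smulₛₗ]

/-- `antiTensor` acts on all product vectors as the tensor product should. -/
theorem antiTensor_prodKet {m n : Type*} [Fintype m] [Fintype n] [DecidableEq m] [DecidableEq n]
    (ΘA : AntiLin m) (ΘB : AntiLin n) (x : Ket m) (y : Ket n) :
    antiTensor ΘA ΘB (prodKet x y) = prodKet (ΘA x) (ΘB y) := by
  rw [antiLin_apply ΘA x, antiLin_apply ΘB y]
  ext p
  simp only [antiTensor, prodKet, LinearMap.coe_mk, AddHom.coe_mk, WithLp.ofLp_sum,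
    WithLp.ofLp_smul, Finset.sum_apply, Pi.smul_apply, smul_eq_mul, map_mul,
    Finset.sum_mul_sum]
  refine Finset.sum_congr rfl fun i _ => Finset.sum_congr rfl fun j _ => ?_
  ring

/-- Expansion of a vector of `ℂ^m ⊗ ℂ^n` in the product basis. -/
theorem ket_eq_sum {m n : Type*} [Fintype m] [Fintype n] [DecidableEq m] [DecidableEq n]
    (ψ : Ket (m × n)) :
    ψ = ∑ i, ∑ j, ψ (i, j) •
      prodKet (EuclideanSpace.single i (1 : ℂ)) (EuclideanSpace.single j (1 : ℂ)) := by
  ext ⟨k, l⟩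
  simp [prodKet, Finset.sum_ite_eq]

/-- The inner product of product vectors. -/
theorem inner_prodKet {m n : Type*} [Fintype m] [Fintype n] (a c : Ket m) (b d : Ket n) :
    inner ℂ (prodKet a b) (prodKet c d) = inner ℂ a c * inner ℂ b d := by
  simp only [PiLp.inner_apply, prodKet, RCLike.inner_apply, map_mul, Fintype.sum_prod_type,
    Finset.sum_mul_sum]
  refine Finset.sum_congr rfl fun i _ => Finset.sum_congr rfl fun j _ => ?_
  ring

/-- The tensor product of two skew-conjugations is a conjugation. -/
theorem isConjugation_antiTensor {m n : Type*} [Fintype m] [Fintype n] [DecidableEq m]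
    [DecidableEq n] {ΘA : AntiLin m} {ΘB : AntiLin n} (hA : IsSkewConjugation ΘA)
    (hB : IsSkewConjugation ΘB) : IsConjugation (antiTensor ΘA ΘB) where
  antiunitary x y := by
    rw [ket_eq_sum x, ket_eq_sum y]
    simp only [map_sum, map_smulₛₗ, antiTensor_prodKet, sum_inner, inner_sum, inner_smul_left,
      inner_smul_right, inner_prodKet, hA.antiunitary, hB.antiunitary, map_mul]
  sq_eq x := by
    have h : ∀ (a : Ket m) (b : Ket n), prodKet (-a) (-b) = prodKet a b := fun a b => by
      ext p
      simp [prodKet]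
    conv_rhs => rw [ket_eq_sum x]
    conv_lhs => rw [ket_eq_sum x]
    simp only [map_sum, map_smulₛₗ, antiTensor_prodKet, hA.sq_eq_neg, hB.sq_eq_neg, h]
    simp

/-- The concurrence of a vector: `C_Θ(ψ) = |⟨ψ|Θψ⟩|`. -/
def pureConcurrence {ι : Type*} [Fintype ι] (Θ : AntiLin ι) (ψ : Ket ι) : ℝ :=
  ‖inner ℂ ψ (Θ ψ)‖

/-- The values `∑ⱼ μⱼ C_Θ(ψⱼ)` over all finite decompositions `ρ = ∑ⱼ μⱼ |ψⱼ⟩⟨ψⱼ|` into unit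
vectors with weights `μⱼ > 0`, `∑ⱼ μⱼ = 1`. -/
def concurrenceValues {ι : Type*} [Fintype ι] (Θ : AntiLin ι) (ρ : Matrix ι ι ℂ) : Set ℝ :=
  {c | ∃ (N : ℕ) (μ : Fin N → ℝ) (ψ : Fin N → Ket ι),
    (∀ j, 0 < μ j) ∧ ∑ j, μ j = 1 ∧ (∀ j, ‖ψ j‖ = 1) ∧
    ρ = ∑ j, (μ j : ℂ) • ketBra (ψ j) ∧
    c = ∑ j, μ j * pureConcurrence Θ (ψ j)}

/-- `C_Θ(ρ) = c`: the convex roof of the pure state concurrence, that is, `c` is the minimum of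
`∑ⱼ μⱼ C_Θ(ψⱼ)` over all decompositions of `ρ`. -/
def HasConcurrence {ι : Type*} [Fintype ι] (Θ : AntiLin ι) (ρ : Matrix ι ι ℂ) (c : ℝ) : Prop :=
  IsLeast (concurrenceValues Θ ρ) c

/-- Zero concurrence states: `C_Θ(ρ) = 0` for every conjugation `Θ = Θ_A ⊗ Θ_B` that is a tensor
product of skew-conjugations (see `isConjugation_antiTensor`). -/
def IsZC {m n : Type*} [Fintype m] [Fintype n] [DecidableEq m] [DecidableEq n]
    (ρ : Matrix (m × n) (m × n) ℂ) : Prop :=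
  ∀ (ΘA : AntiLin m) (ΘB : AntiLin n), IsSkewConjugation ΘA → IsSkewConjugation ΘB →
    HasConcurrence (antiTensor ΘA ΘB) ρ 0

/-- `ρ = lam |ψ₁⟩⟨ψ₁| + (1 - lam) |ψ₂⟩⟨ψ₂|` with `0 < lam < 1` and `ψ₁`, `ψ₂` orthonormal
(hence eigenvectors for the nonzero eigenvalues). -/
structure IsSpectralForm {ι : Type*} [Fintype ι] (lam : ℝ) (ψ₁ ψ₂ : Ket ι)
    (ρ : Matrix ι ι ℂ) : Prop where
  lam_pos : 0 < lam
  lam_lt_one : lam < 1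
  norm_fst : ‖ψ₁‖ = 1
  norm_snd : ‖ψ₂‖ = 1
  orthogonal : inner ℂ ψ₁ ψ₂ = 0
  eq_mix : ρ = (lam : ℂ) • ketBra ψ₁ + ((1 - lam : ℝ) : ℂ) • ketBra ψ₂

/-- The basis vector `|a_{i+1}, b_{j+1}⟩` of `ℂ² ⊗ ℂ⁴` (indices start at 0). -/
def basisKet (i : Fin 2) (j : Fin 4) : Ket (Fin 2 × Fin 4) :=
  prodKet (EuclideanSpace.single i 1) (EuclideanSpace.single j 1)

/-- `(X₁ ⊗ X₂) ρ (X₁† ⊗ X₂†)`. -/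
def localTransform (X₁ : Matrix (Fin 2) (Fin 2) ℂ) (X₂ : Matrix (Fin 4) (Fin 4) ℂ)
    (ρ : Matrix (Fin 2 × Fin 4) (Fin 2 × Fin 4) ℂ) :
    Matrix (Fin 2 × Fin 4) (Fin 2 × Fin 4) ℂ :=
  (X₁ ⊗ₖ X₂) * ρ * (X₁ᴴ ⊗ₖ X₂ᴴ)

/-- `ρ` is in canonical form, with parameters `lam`, `q₁`, `q₆` and
`ψ₂ = (p₁, …, p₈)`: here `ψ₁ = q₁|a₁,b₁⟩ + q₆|a₂,b₂⟩`, `q₁, q₆ > 0`, `p₁ ≥ 0 ≥ p₆` are real,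
`p₄ = 0` and `p₁ q₁ + p₆ q₆ = 0`. In the coordinates used here `p₁`, `p₄`, `p₆` are the entries
of `ψ₂` at `(0, 0)`, `(0, 3)`, `(1, 1)`. -/
structure IsCanonicalForm (lam q₁ q₆ : ℝ) (ψ₂ : Ket (Fin 2 × Fin 4))
    (ρ : Matrix (Fin 2 × Fin 4) (Fin 2 × Fin 4) ℂ) : Prop where
  spectral : IsSpectralForm lam
    ((q₁ : ℂ) • basisKet 0 0 + (q₆ : ℂ) • basisKet 1 1) ψ₂ ρ
  q₁_pos : 0 < q₁
  q₆_pos : 0 < q₆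
  p₁_nonneg : 0 ≤ (ψ₂ (0, 0)).re
  p₁_real : (ψ₂ (0, 0)).im = 0
  p₆_nonpos : (ψ₂ (1, 1)).re ≤ 0
  p₆_real : (ψ₂ (1, 1)).im = 0
  p₄_zero : ψ₂ (0, 3) = 0
  p_orth : ψ₂ (0, 0) * (q₁ : ℂ) + ψ₂ (1, 1) * (q₆ : ℂ) = 0

/-- The two qubit matrix made of the entries of `ρ` whose `B`-indices are `b₁` or `b₂`. -/
def qubitBlock (ρ : Matrix (Fin 2 × Fin 4) (Fin 2 × Fin 4) ℂ) :
    Matrix (Fin 2 × Fin 2) (Fin 2 × Fin 2) ℂ :=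
  Matrix.of (fun p q =>
    ρ (p.1, Fin.castLE (by norm_num) p.2) (q.1, Fin.castLE (by norm_num) q.2))

/-- The block form
`[[ρ₁₁, 0, ρ₁₂, 0], [0, 0, 0, 0], [ρ₁₂†, 0, ρ₂₂, 0], [0, 0, 0, 0]]` (`2 × 2` blocks) where
`[[ρ₁₁, ρ₁₂], [ρ₁₂†, ρ₂₂]]` is separable as a two qubit state. -/
structure IsQubitBlockForm (ρ : Matrix (Fin 2 × Fin 4) (Fin 2 × Fin 4) ℂ) : Prop where
  row_zero : ∀ (i : Fin 2) (j : Fin 4) (q : Fin 2 × Fin 4), 2 ≤ j.val → ρ (i, j) q = 0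
  col_zero : ∀ (p : Fin 2 × Fin 4) (i : Fin 2) (j : Fin 4), 2 ≤ j.val → ρ p (i, j) = 0
  block_separable : IsSeparable (qubitBlock ρ)

/-- The class `ZCS`. -/
def IsZCS (ρ : Matrix (Fin 2 × Fin 4) (Fin 2 × Fin 4) ℂ) : Prop :=
  (∃ (lam : ℝ) (ψ₁ ψ₂ : Ket (Fin 2 × Fin 4)),
    IsSpectralForm lam ψ₁ ψ₂ ρ ∧ IsProductKet ψ₁ ∧ IsProductKet ψ₂) ∨
  (IsPPT ρ ∧ ∃ X₁ ∈ Matrix.specialUnitaryGroup (Fin 2) ℂ,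
    ∃ X₂ ∈ Matrix.specialUnitaryGroup (Fin 4) ℂ,
    ∃ (lam q₁ q₆ : ℝ) (ψ₂ : Ket (Fin 2 × Fin 4)),
      IsCanonicalForm lam q₁ q₆ ψ₂ (localTransform X₁ X₂ ρ) ∧
      IsQubitBlockForm (localTransform X₁ X₂ ρ))

/-- The class `ZCE`: up to a local transformation, `ρ` is in canonical form with `lam = 1/2` and
`ψ₂ = q₁|a₁,b₃⟩ + q₆ e^{iφ}|a₂,b₄⟩`. -/
def IsZCE (ρ : Matrix (Fin 2 × Fin 4) (Fin 2 × Fin 4) ℂ) : Prop :=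
  ∃ X₁ ∈ Matrix.specialUnitaryGroup (Fin 2) ℂ,
  ∃ X₂ ∈ Matrix.specialUnitaryGroup (Fin 4) ℂ,
  ∃ q₁ q₆ φ : ℝ,
    IsCanonicalForm (1 / 2) q₁ q₆
      ((q₁ : ℂ) • basisKet 0 2 + ((q₆ : ℂ) * Complex.exp (Complex.I * φ)) • basisKet 1 3)
      (localTransform X₁ X₂ ρ)

end Concurrence

end

/-! Write a vector of ℂ² ⊗ ℂ⁴ as a pair of rows x, y in ℂ⁴. Skew-conjugations of ℂ² differ only by a
phase, so up to a constant factor every concurrence in question is |xᵀSy| with S antisymmetric and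
unitary. Hence ρ is ZC iff for each such S it has an ensemble of isotropic vectors of the quadratic
form xᵀSy (`isZC_iff`).

On the two-dimensional range of ρ this is a binary quadratic form with symmetric matrix T. Such an
ensemble forces T, weighted by the eigenvalues, to be a multiple of a unitary matrix
(`normSq_eq_of_isotropic_mixture`). Conversely, for equal eigenvalues a multiple of a unitary matrix
has an orthonormal pair of isotropic vectors (`exists_isotropic_pair`).

Necessity: if both eigenvectors are products, nothing remains. Otherwise put an entangled one in
Schmidt form on b₁, b₂ and test with the forms `skewMat s t u`. Those with s = 0 vanish on the first
eigenvector, hence on the second; those with t = u = 0 give a real-linear function of s with |value|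
proportional to |s|. Together they confine the second eigenvector to b₁, b₂ or to b₃, b₄
(`IsRowIsotropic.support_dichotomy`). In the first case one form is the two-qubit determinant, so
isotropic vectors are products and ρ is separable. In the second case the off-diagonal relation
fixes the eigenvalues and the second eigenvector up to a unitary of the b₃, b₄ plane, giving ZCE.

Sufficiency: product vectors are isotropic for every skew form, and for ZCE unitarity of S makes T a
multiple of a unitary. The classes are disjoint because the range of a ZCE state contains no nonzero
product vector. -/

noncomputable section

namespace Concurrence

/-! ### Ensembles, spectral forms and separability -/

section Basics

variable {ι κ m n m' n' : Type*}

/-- The action of a matrix on vectors of `ℂ^ι`. -/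
def mulKet [Fintype ι] (U : Matrix κ ι ℂ) (ψ : Ket ι) : Ket κ :=
  WithLp.toLp 2 (U *ᵥ ψ.ofLp)

theorem mulKet_apply [Fintype ι] (U : Matrix κ ι ℂ) (ψ : Ket ι) (k : κ) :
    mulKet U ψ k = ∑ i, U k i * ψ i := rfl

theorem inner_eq_sum [Fintype ι] (x y : Ket ι) : inner ℂ x y = ∑ i, star (x i) * y i := by
  simp [PiLp.inner_apply, mul_comm]

theorem inner_mulKet [Fintype ι] [Fintype κ] [DecidableEq ι] {U : Matrix κ ι ℂ} (hU : Uᴴ * U = 1)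
    (x y : Ket ι) : inner ℂ (mulKet U x) (mulKet U y) = inner ℂ x y := by
  rw [EuclideanSpace.inner_eq_star_dotProduct, EuclideanSpace.inner_eq_star_dotProduct]
  simp only [mulKet]
  rw [Matrix.star_mulVec, dotProduct_comm, ← Matrix.dotProduct_mulVec, Matrix.mulVec_mulVec, hU,
    Matrix.one_mulVec, dotProduct_comm]

theorem norm_eq_one_iff_inner [Fintype ι] (x : Ket ι) : ‖x‖ = 1 ↔ inner ℂ x x = (1 : ℂ) := by
  rw [inner_self_eq_norm_sq_to_K]
  constructor
  · intro h
    simp [h]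
  · intro h
    have : (‖x‖ : ℝ) ^ 2 = 1 := by
      rw [← Complex.ofReal_inj]
      simpa using h
    nlinarith [norm_nonneg x]

theorem norm_mulKet [Fintype ι] [Fintype κ] [DecidableEq ι] {U : Matrix κ ι ℂ} (hU : Uᴴ * U = 1)
    (x : Ket ι) : ‖mulKet U x‖ = ‖x‖ := by
  rw [@norm_eq_sqrt_re_inner ℂ, @norm_eq_sqrt_re_inner ℂ _ _ _ _ x, inner_mulKet hU]

theorem ketBra_mulKet [Fintype ι] (U : Matrix κ ι ℂ) (ψ : Ket ι) :
    ketBra (mulKet U ψ) = U * ketBra ψ * Uᴴ := by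
  change Matrix.vecMulVec (U *ᵥ ψ.ofLp) (star (U *ᵥ ψ.ofLp)) =
    U * Matrix.vecMulVec ψ.ofLp (star ψ.ofLp) * Uᴴ
  rw [Matrix.mul_vecMulVec, Matrix.vecMulVec_mul, ← Matrix.star_mulVec]

theorem ketBra_smul (c : ℂ) (ψ : Ket ι) : ketBra (c • ψ) = (c * star c) • ketBra ψ := by
  ext i j
  simp [ketBra]
  ring

theorem posSemidef_ketBra [Finite ι] (ψ : Ket ι) : (ketBra ψ).PosSemidef :=
  Matrix.posSemidef_vecMulVec_self_star ψ.ofLp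

theorem trace_ketBra [Fintype ι] (ψ : Ket ι) : (ketBra ψ).trace = inner ℂ ψ ψ := by
  rw [inner_eq_sum]
  exact Finset.sum_congr rfl fun i _ => mul_comm _ _

theorem ketBra_prodKet (a : Ket m) (b : Ket n) :
    ketBra (prodKet a b) = ketBra a ⊗ₖ ketBra b := by
  ext p q
  simp [ketBra, prodKet]
  ring

theorem mulKet_kronecker_prodKet [Fintype m] [Fintype n] (A : Matrix m' m ℂ) (B : Matrix n' n ℂ)
    (a : Ket m) (b : Ket n) :
    mulKet (A ⊗ₖ B) (prodKet a b) = prodKet (mulKet A a) (mulKet B b) := by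
  ext p
  simp only [mulKet_apply, prodKet, Matrix.kroneckerMap_apply, Fintype.sum_prod_type,
    Finset.sum_mul_sum]
  exact Finset.sum_congr rfl fun i _ => Finset.sum_congr rfl fun j _ => by ring

theorem norm_prodKet [Fintype m] [Fintype n] (a : Ket m) (b : Ket n) :
    ‖prodKet a b‖ = ‖a‖ * ‖b‖ := by
  have h := inner_prodKet a a b b
  rw [inner_self_eq_norm_sq_to_K, inner_self_eq_norm_sq_to_K, inner_self_eq_norm_sq_to_K] at h
  have h2 : ‖prodKet a b‖ ^ 2 = (‖a‖ * ‖b‖) ^ 2 := by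
    rw [mul_pow]
    exact_mod_cast h
  exact (pow_left_inj₀ (norm_nonneg _) (by positivity) two_ne_zero).1 h2

/-- `ρ = ∑ⱼ μⱼ |φⱼ⟩⟨φⱼ|` with unit vectors `φⱼ` and positive weights `μⱼ` of sum one. -/
structure IsEnsemble [Fintype ι] {N : ℕ} (μ : Fin N → ℝ) (φ : Fin N → Ket ι)
    (ρ : Matrix ι ι ℂ) : Prop where
  pos : ∀ j, 0 < μ j
  sum_eq_one : ∑ j, μ j = 1
  norm_eq_one : ∀ j, ‖φ j‖ = 1
  eq_sum : ρ = ∑ j, (μ j : ℂ) • ketBra (φ j)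

theorem IsEnsemble.map [Fintype ι] [Fintype κ] [DecidableEq ι] {N : ℕ} {μ : Fin N → ℝ}
    {φ : Fin N → Ket ι} {ρ : Matrix ι ι ℂ} (h : IsEnsemble μ φ ρ) {U : Matrix κ ι ℂ}
    (hU : Uᴴ * U = 1) : IsEnsemble μ (fun j => mulKet U (φ j)) (U * ρ * Uᴴ) where
  pos := h.pos
  sum_eq_one := h.sum_eq_one
  norm_eq_one j := by rw [norm_mulKet hU, h.norm_eq_one]
  eq_sum := by
    rw [h.eq_sum, Matrix.mul_sum, Matrix.sum_mul]
    refine Finset.sum_congr rfl fun j _ => ?_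
    rw [ketBra_mulKet, Matrix.mul_smul, Matrix.smul_mul]

theorem isSeparable_iff [Fintype m] [Fintype n] {ρ : Matrix (m × n) (m × n) ℂ} :
    IsSeparable ρ ↔ ∃ (N : ℕ) (μ : Fin N → ℝ) (φ : Fin N → Ket (m × n)),
      IsEnsemble μ φ ρ ∧ ∀ j, IsProductKet (φ j) := by
  constructor
  · rintro ⟨N, μ, a, b, hμ, hs, ha, hb, rfl⟩
    refine ⟨N, μ, fun j => prodKet (a j) (b j), ⟨hμ, hs, fun j => ?_, ?_⟩, fun j => ⟨_, _, rfl⟩⟩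
    · rw [norm_prodKet, ha, hb, one_mul]
    · simp only [ketBra_prodKet]
  · rintro ⟨N, μ, φ, h, hp⟩
    choose a b hab using hp
    have hn : ∀ j, ‖a j‖ * ‖b j‖ = 1 := fun j => by
      rw [← norm_prodKet, ← hab, h.norm_eq_one]
    have ha : ∀ j, ‖a j‖ ≠ 0 := fun j => left_ne_zero_of_mul_eq_one (hn j)
    -- Only the product of the two norms is known to be 1, so a scalar is moved from one factor to
    -- the other.
    refine ⟨N, μ, fun j => ((‖a j‖ : ℂ)⁻¹) • a j, fun j => (‖a j‖ : ℂ) • b j, h.pos, h.sum_eq_one,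
      fun j => ?_, fun j => ?_, ?_⟩
    · rw [norm_smul, norm_inv, Complex.norm_real, norm_norm, inv_mul_cancel₀ (ha j)]
    · rw [norm_smul, Complex.norm_real, norm_norm, hn]
    · rw [h.eq_sum]
      refine Finset.sum_congr rfl fun j _ => ?_
      rw [← ketBra_prodKet, hab j]
      congr 2
      ext p
      have : (‖a j‖ : ℂ) ≠ 0 := by exact_mod_cast ha j
      simp only [prodKet, PiLp.smul_apply, smul_eq_mul]
      field_simp

theorem kronecker_isometry [Fintype m] [Fintype n] [Fintype m'] [Fintype n'] [DecidableEq m]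
    [DecidableEq n] {A : Matrix m' m ℂ} {B : Matrix n' n ℂ} (hA : Aᴴ * A = 1) (hB : Bᴴ * B = 1) :
    (A ⊗ₖ B)ᴴ * (A ⊗ₖ B) = 1 := by
  rw [Matrix.conjTranspose_kronecker, ← Matrix.mul_kronecker_mul, hA, hB, Matrix.one_kronecker_one]

theorem IsSeparable.map [Fintype m] [Fintype n] [Fintype m'] [Fintype n'] [DecidableEq m]
    [DecidableEq n] {ρ : Matrix (m × n) (m × n) ℂ} (h : IsSeparable ρ) {A : Matrix m' m ℂ}
    {B : Matrix n' n ℂ} (hA : Aᴴ * A = 1) (hB : Bᴴ * B = 1) :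
    IsSeparable ((A ⊗ₖ B) * ρ * (A ⊗ₖ B)ᴴ) := by
  obtain ⟨N, μ, φ, he, hp⟩ := isSeparable_iff.1 h
  refine isSeparable_iff.2 ⟨N, μ, _, he.map (kronecker_isometry hA hB), fun j => ?_⟩
  obtain ⟨a, b, hab⟩ := hp j
  exact ⟨mulKet A a, mulKet B b, by rw [hab, mulKet_kronecker_prodKet]⟩

theorem IsSeparable.isPPT [Fintype m] [Fintype n] {ρ : Matrix (m × n) (m × n) ℂ}
    (h : IsSeparable ρ) : IsPPT ρ := by
  obtain ⟨N, μ, a, b, hμ, -, -, -, rfl⟩ := h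
  have : partialTranspose (∑ j, (μ j : ℂ) • (ketBra (a j) ⊗ₖ ketBra (b j))) =
      ∑ j, (μ j : ℂ) • ((ketBra (a j))ᵀ ⊗ₖ ketBra (b j)) := by
    ext p q
    simp [partialTranspose, Matrix.sum_apply]
  rw [IsPPT, this]
  refine Matrix.posSemidef_sum _ fun j _ => ?_
  refine Matrix.PosSemidef.smul ?_ (by exact_mod_cast (hμ j).le)
  classical
  exact (posSemidef_ketBra _).transpose.kronecker (posSemidef_ketBra _)

/-- A spectral decomposition as an ensemble. -/
theorem IsSpectralForm.isEnsemble [Fintype ι] {lam : ℝ} {ψ₁ ψ₂ : Ket ι} {ρ : Matrix ι ι ℂ}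
    (h : IsSpectralForm lam ψ₁ ψ₂ ρ) : IsEnsemble ![lam, 1 - lam] ![ψ₁, ψ₂] ρ where
  pos j := by
    fin_cases j
    · exact h.lam_pos
    · exact sub_pos.2 h.lam_lt_one
  sum_eq_one := by simp
  norm_eq_one j := by
    fin_cases j
    · exact h.norm_fst
    · exact h.norm_snd
  eq_sum := by
    rw [h.eq_mix, Fin.sum_univ_two]
    rfl

theorem IsSpectralForm.swap [Fintype ι] {lam : ℝ} {ψ₁ ψ₂ : Ket ι} {ρ : Matrix ι ι ℂ}
    (h : IsSpectralForm lam ψ₁ ψ₂ ρ) : IsSpectralForm (1 - lam) ψ₂ ψ₁ ρ where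
  lam_pos := sub_pos.2 h.lam_lt_one
  lam_lt_one := by linarith [h.lam_pos]
  norm_fst := h.norm_snd
  norm_snd := h.norm_fst
  orthogonal := inner_eq_zero_symm.1 h.orthogonal
  eq_mix := by rw [h.eq_mix, add_comm, sub_sub_cancel]

theorem IsSpectralForm.map [Fintype ι] [Fintype κ] [DecidableEq ι] {lam : ℝ} {ψ₁ ψ₂ : Ket ι}
    {ρ : Matrix ι ι ℂ} (h : IsSpectralForm lam ψ₁ ψ₂ ρ) {U : Matrix κ ι ℂ} (hU : Uᴴ * U = 1) :
    IsSpectralForm lam (mulKet U ψ₁) (mulKet U ψ₂) (U * ρ * Uᴴ) where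
  lam_pos := h.lam_pos
  lam_lt_one := h.lam_lt_one
  norm_fst := by rw [norm_mulKet hU, h.norm_fst]
  norm_snd := by rw [norm_mulKet hU, h.norm_snd]
  orthogonal := by rw [inner_mulKet hU, h.orthogonal]
  eq_mix := by
    rw [h.eq_mix, ketBra_mulKet, ketBra_mulKet]
    simp only [Matrix.mul_add, Matrix.add_mul, Matrix.mul_smul, Matrix.smul_mul]

theorem IsSpectralForm.smul_snd [Fintype ι] {lam : ℝ} {ψ₁ ψ₂ : Ket ι} {ρ : Matrix ι ι ℂ}
    (h : IsSpectralForm lam ψ₁ ψ₂ ρ) {c : ℂ} (hc : ‖c‖ = 1) :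
    IsSpectralForm lam ψ₁ (c • ψ₂) ρ where
  lam_pos := h.lam_pos
  lam_lt_one := h.lam_lt_one
  norm_fst := h.norm_fst
  norm_snd := by rw [norm_smul, hc, one_mul, h.norm_snd]
  orthogonal := by rw [inner_smul_right, h.orthogonal, mul_zero]
  eq_mix := by
    have : c * star c = 1 := by
      rw [Complex.star_def, Complex.mul_conj, Complex.normSq_eq_norm_sq, hc]
      simp
    rw [h.eq_mix, ketBra_smul, this, one_smul]

theorem IsEnsemble.isState [Fintype ι] {N : ℕ} {μ : Fin N → ℝ} {φ : Fin N → Ket ι}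
    {ρ : Matrix ι ι ℂ} (h : IsEnsemble μ φ ρ) : IsState ρ where
  posSemidef := by
    rw [h.eq_sum]
    refine Matrix.posSemidef_sum _ fun j _ => ?_
    exact (posSemidef_ketBra _).smul (by exact_mod_cast (h.pos j).le)
  trace_eq_one := by
    rw [h.eq_sum, Matrix.trace_sum]
    simp only [Matrix.trace_smul, trace_ketBra, (norm_eq_one_iff_inner _).1 (h.norm_eq_one _),
      smul_eq_mul, mul_one]
    exact_mod_cast h.sum_eq_one

/-- Factor ρ = A Aᴴ, the columns of A being the eigenvectors scaled by square roots of the weights.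
The rank equals that of Aᴴ A, an invertible diagonal 2 × 2 matrix. -/
theorem IsSpectralForm.rank_eq_two [Fintype ι] {lam : ℝ} {ψ₁ ψ₂ : Ket ι} {ρ : Matrix ι ι ℂ}
    (h : IsSpectralForm lam ψ₁ ψ₂ ρ) : ρ.rank = 2 := by
  classical
  have h0 := h.lam_pos
  have h1 := h.lam_lt_one
  set A : Matrix ι (Fin 2) ℂ := Matrix.of fun i k =>
    ![(Real.sqrt lam : ℂ) * ψ₁ i, (Real.sqrt (1 - lam) : ℂ) * ψ₂ i] k with hA
  have s0 : (Real.sqrt lam : ℂ) * Real.sqrt lam = lam := by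
    exact_mod_cast Real.mul_self_sqrt h0.le
  have s1 : (Real.sqrt (1 - lam) : ℂ) * Real.sqrt (1 - lam) = ((1 - lam : ℝ) : ℂ) := by
    exact_mod_cast Real.mul_self_sqrt (sub_pos.2 h1).le
  have e1 : ρ = A * Aᴴ := by
    rw [h.eq_mix]
    ext i j
    simp only [hA, Matrix.mul_apply, Fin.sum_univ_two, Matrix.conjTranspose_apply, Matrix.of_apply,
      Matrix.cons_val_zero, Matrix.cons_val_one, Matrix.add_apply, Matrix.smul_apply, ketBra,
      smul_eq_mul, Complex.star_def, map_mul, Complex.conj_ofReal]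
    rw [← s0, ← s1]
    ring
  have e2 : Aᴴ * A = Matrix.diagonal ![(lam : ℂ), ((1 - lam : ℝ) : ℂ)] := by
    have i11 := (norm_eq_one_iff_inner _).1 h.norm_fst
    have i22 := (norm_eq_one_iff_inner _).1 h.norm_snd
    have i12 := h.orthogonal
    have i21 := inner_eq_zero_symm.1 h.orthogonal
    rw [inner_eq_sum] at i11 i22 i12 i21
    have key : ∀ (x y : ℝ) (f g : Ket ι), ∑ i, star ((x : ℂ) * f i) * ((y : ℂ) * g i) =
        (x : ℂ) * y * ∑ i, star (f i) * g i := fun x y f g => by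
      rw [Finset.mul_sum]
      refine Finset.sum_congr rfl fun i _ => ?_
      simp only [Complex.star_def, map_mul, Complex.conj_ofReal]
      ring
    ext k l
    fin_cases k <;> fin_cases l <;>
      simp only [hA, Matrix.mul_apply, Matrix.conjTranspose_apply, Matrix.of_apply,
        Fin.zero_eta, Fin.mk_one, Matrix.cons_val_zero, Matrix.cons_val_one, key, i11, i22, i12, i21,
        s0, s1, mul_one, mul_zero] <;> simp
  rw [e1, Matrix.rank_self_mul_conjTranspose, ← Matrix.rank_conjTranspose_mul_self, e2,
    Matrix.rank_of_isUnit _ (by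
      rw [Matrix.isUnit_iff_isUnit_det, Matrix.det_diagonal, Fin.prod_univ_two, isUnit_iff_ne_zero]
      simp only [Matrix.cons_val_zero, Matrix.cons_val_one]
      exact mul_ne_zero (by exact_mod_cast h0.ne') (by exact_mod_cast (sub_pos.2 h1).ne'))]
  simp

theorem IsState.exists_isSpectralForm [Fintype ι] {ρ : Matrix ι ι ℂ} (hρ : IsState ρ)
    (hr : ρ.rank = 2) : ∃ (lam : ℝ) (ψ₁ ψ₂ : Ket ι), IsSpectralForm lam ψ₁ ψ₂ ρ := by
  classical
  have hH := hρ.posSemidef.isHermitian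
  have hc := hH.rank_eq_card_non_zero_eigs
  rw [hr, Fintype.card_subtype, eq_comm, Finset.card_eq_two] at hc
  obtain ⟨a, b, hab, hS⟩ := hc
  have hmem : ∀ i, hH.eigenvalues i ≠ 0 ↔ i = a ∨ i = b := fun i => by
    have := congrArg (i ∈ ·) hS
    simpa using this
  have hsum : ∀ {M : Type} [AddCommMonoid M] (f : ι → M), (∀ i, hH.eigenvalues i = 0 → f i = 0) →
      ∑ i, f i = f a + f b := fun f hf => by
    rw [← Finset.sum_pair hab]
    refine (Finset.sum_subset (Finset.subset_univ _) fun i _ hi => hf i ?_).symm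
    by_contra hne
    exact hi (by simpa using (hmem i).1 hne)
  have ha : 0 < hH.eigenvalues a :=
    lt_of_le_of_ne (hρ.posSemidef.eigenvalues_nonneg a) (Ne.symm ((hmem a).2 (Or.inl rfl)))
  have hb : 0 < hH.eigenvalues b :=
    lt_of_le_of_ne (hρ.posSemidef.eigenvalues_nonneg b) (Ne.symm ((hmem b).2 (Or.inr rfl)))
  have ht := hH.trace_eq_sum_eigenvalues
  rw [hρ.trace_eq_one] at ht
  replace ht := ht.trans (hsum (fun i => (hH.eigenvalues i : ℂ)) (fun i hi => by simp [hi]))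
  have ht' : hH.eigenvalues b = 1 - hH.eigenvalues a := by
    have : (1 : ℝ) = hH.eigenvalues a + hH.eigenvalues b := by exact_mod_cast ht
    linarith
  refine ⟨hH.eigenvalues a, hH.eigenvectorBasis a, hH.eigenvectorBasis b, ha, by linarith,
    hH.eigenvectorBasis.orthonormal.1 a, hH.eigenvectorBasis.orthonormal.1 b,
    hH.eigenvectorBasis.orthonormal.2 hab, ?_⟩
  have hsp := hH.spectral_theorem
  rw [Unitary.conjStarAlgAut_apply] at hsp
  ext p q
  conv_lhs => rw [hsp]
  rw [Matrix.mul_apply]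
  simp only [Matrix.mul_diagonal, Function.comp_apply, Matrix.star_apply,
    Matrix.IsHermitian.eigenvectorUnitary_apply]
  rw [hsum _ (fun i hi => by simp [hi]), ← ht']
  simp [ketBra]
  ring

/-- Both sides are ⟨x|ρ|y⟩, so the left side does not depend on the ensemble; this is how two
ensembles of one state are compared. -/
theorem IsEnsemble.sum_inner_mul_inner [Fintype ι] {N : ℕ} {μ : Fin N → ℝ} {φ : Fin N → Ket ι}
    {ρ : Matrix ι ι ℂ} (h : IsEnsemble μ φ ρ) (x y : Ket ι) :
    ∑ j, (μ j : ℂ) * (inner ℂ x (φ j) * inner ℂ (φ j) y) =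
      ∑ p, ∑ q, star (x p) * ρ p q * y q := by
  have hj : ∀ j, (μ j : ℂ) * (inner ℂ x (φ j) * inner ℂ (φ j) y) =
      ∑ p, ∑ q, star (x p) * ((μ j : ℂ) * (φ j p * star (φ j q))) * y q := fun j => by
    rw [inner_eq_sum, inner_eq_sum, Finset.sum_mul_sum, Finset.mul_sum]
    refine Finset.sum_congr rfl fun p _ => ?_
    rw [Finset.mul_sum]
    exact Finset.sum_congr rfl fun q _ => by ring
  simp only [hj]
  rw [Finset.sum_comm]
  refine Finset.sum_congr rfl fun p _ => ?_
  rw [Finset.sum_comm]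
  refine Finset.sum_congr rfl fun q _ => ?_
  rw [h.eq_sum, Matrix.sum_apply, Finset.mul_sum, Finset.sum_mul]
  rfl

theorem IsEnsemble.sum_inner_eq_of_isSpectralForm [Fintype ι] {lam : ℝ} {ψ₁ ψ₂ : Ket ι}
    {ρ : Matrix ι ι ℂ} {N : ℕ} {μ : Fin N → ℝ} {φ : Fin N → Ket ι} (he : IsEnsemble μ φ ρ)
    (h : IsSpectralForm lam ψ₁ ψ₂ ρ) (x y : Ket ι) :
    ∑ j, (μ j : ℂ) * (inner ℂ x (φ j) * inner ℂ (φ j) y) =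
      lam * (inner ℂ x ψ₁ * inner ℂ ψ₁ y) + ((1 - lam : ℝ) : ℂ) * (inner ℂ x ψ₂ * inner ℂ ψ₂ y) := by
  rw [he.sum_inner_mul_inner, ← h.isEnsemble.sum_inner_mul_inner, Fin.sum_univ_two]
  rfl

/-- The vectors of an ensemble lie in the range of the state. -/
theorem IsEnsemble.eq_add_of_isSpectralForm [Fintype ι] {lam : ℝ} {ψ₁ ψ₂ : Ket ι}
    {ρ : Matrix ι ι ℂ} {N : ℕ} {μ : Fin N → ℝ} {φ : Fin N → Ket ι} (he : IsEnsemble μ φ ρ)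
    (h : IsSpectralForm lam ψ₁ ψ₂ ρ) (j : Fin N) :
    φ j = (inner ℂ ψ₁ (φ j) : ℂ) • ψ₁ + (inner ℂ ψ₂ (φ j) : ℂ) • ψ₂ := by
  have i11 := (norm_eq_one_iff_inner _).1 h.norm_fst
  have i22 := (norm_eq_one_iff_inner _).1 h.norm_snd
  have i12 := h.orthogonal
  have i21 := inner_eq_zero_symm.1 h.orthogonal
  -- χ is the component of φ j orthogonal to both eigenvectors. Then ⟨χ|ρ|χ⟩ = 0 is a sum of
  -- nonnegative terms, so χ is orthogonal to φ j and hence to itself.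
  set χ := φ j - ((inner ℂ ψ₁ (φ j) : ℂ) • ψ₁ + (inner ℂ ψ₂ (φ j) : ℂ) • ψ₂) with hχ
  have h1 : inner ℂ ψ₁ χ = (0 : ℂ) := by
    rw [hχ, inner_sub_right, inner_add_right, inner_smul_right, inner_smul_right, i11, i12]
    ring
  have h2 : inner ℂ ψ₂ χ = (0 : ℂ) := by
    rw [hχ, inner_sub_right, inner_add_right, inner_smul_right, inner_smul_right, i22, i21]
    ring
  have h3 := he.sum_inner_eq_of_isSpectralForm h χ χ
  have h4 : ∀ k, (μ k : ℂ) * (inner ℂ χ (φ k) * inner ℂ (φ k) χ) =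
      ((μ k * ‖(inner ℂ χ (φ k) : ℂ)‖ ^ 2 : ℝ) : ℂ) := fun k => by
    rw [← inner_conj_symm (φ k) χ, Complex.mul_conj, Complex.normSq_eq_norm_sq]
    push_cast
    rfl
  rw [h1, h2, mul_zero, mul_zero, mul_zero, mul_zero, add_zero] at h3
  simp only [h4] at h3
  have h5 : ∑ k, μ k * ‖(inner ℂ χ (φ k) : ℂ)‖ ^ 2 = 0 := by exact_mod_cast h3
  have h6 := (Finset.sum_eq_zero_iff_of_nonneg fun k _ =>
    mul_nonneg (he.pos k).le (sq_nonneg _)).1 h5 j (Finset.mem_univ _)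
  have h7 : inner ℂ χ (φ j) = (0 : ℂ) := by
    simpa [(he.pos j).ne'] using h6
  have h8 : inner ℂ χ χ = (0 : ℂ) := by
    conv_lhs => rw [hχ, inner_sub_right, inner_add_right, inner_smul_right, inner_smul_right]
    rw [← hχ, h7, inner_eq_zero_symm.1 h1, inner_eq_zero_symm.1 h2]
    ring
  exact sub_eq_zero.1 (inner_self_eq_zero.1 h8)

end Basics

/-! ### From skew-conjugations to antisymmetric bilinear forms -/

section SkewForms

variable {ι m n : Type*}

/-- The anti-linear operator `x ↦ M x̄`. -/
def matAntiLin [Fintype ι] (M : Matrix ι ι ℂ) : AntiLin ι where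
  toFun x := WithLp.toLp 2 (M *ᵥ star x.ofLp)
  map_add' x y := by
    ext k
    simp [Matrix.mulVec_add]
  map_smul' c x := by
    ext k
    simp [Matrix.mulVec_smul]

theorem matAntiLin_single [Fintype ι] [DecidableEq ι] (M : Matrix ι ι ℂ) (i k : ι) :
    matAntiLin M (EuclideanSpace.single i 1) k = M k i := by
  have : star (Pi.single i (1 : ℂ) : ι → ℂ) = Pi.single i 1 := by
    ext l
    simp [Pi.single_apply, apply_ite]
  simp [matAntiLin, this]

theorem isSkewConjugation_matAntiLin [Fintype ι] [DecidableEq ι] {M : Matrix ι ι ℂ}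
    (hM : Mᵀ = -M) (hU : M * Mᴴ = 1) : IsSkewConjugation (matAntiLin M) where
  antiunitary x y := by
    have h := inner_mulKet (mul_eq_one_comm.1 hU) (WithLp.toLp 2 (star x.ofLp) : Ket ι)
      (WithLp.toLp 2 (star y.ofLp))
    refine h.trans ?_
    simp [inner_eq_sum]
  sq_eq_neg x := by
    have h1 : star (M *ᵥ star x.ofLp) = -(Mᴴ *ᵥ x.ofLp) := by
      rw [Matrix.star_mulVec, star_star, ← Matrix.mulVec_transpose, ← Matrix.neg_mulVec]
      congr 1
      change (Mᵀ)ᴴ = -Mᴴ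
      rw [hM, Matrix.conjTranspose_neg]
    change WithLp.toLp 2 (M *ᵥ star (M *ᵥ star x.ofLp)) = -x
    rw [h1, Matrix.mulVec_neg, Matrix.mulVec_mulVec, hU, Matrix.one_mulVec]
    rfl

theorem IsSkewConjugation.inner_antisymm [Fintype ι] {Θ : AntiLin ι} (h : IsSkewConjugation Θ)
    (x y : Ket ι) : (inner ℂ x (Θ y) : ℂ) = -inner ℂ y (Θ x) := by
  have h1 := h.antiunitary y (Θ x)
  rw [h.sq_eq_neg, inner_neg_right] at h1
  rw [← inner_conj_symm x (Θ y), ← neg_eq_iff_eq_neg, ← map_neg, h1, starRingEnd_self_apply]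

/-- The matrix of an anti-linear operator. -/
def matOf [DecidableEq ι] (Θ : AntiLin ι) : Matrix ι ι ℂ :=
  Matrix.of fun k i => Θ (EuclideanSpace.single i 1) k

theorem matOf_transpose [Fintype ι] [DecidableEq ι] {Θ : AntiLin ι} (h : IsSkewConjugation Θ) :
    (matOf Θ)ᵀ = -matOf Θ := by
  ext i k
  have := h.inner_antisymm (EuclideanSpace.single k (1 : ℂ)) (EuclideanSpace.single i 1)
  simpa [matOf, EuclideanSpace.inner_single_left] using this

theorem matOf_mul_conjTranspose [Fintype ι] [DecidableEq ι] {Θ : AntiLin ι}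
    (h : IsSkewConjugation Θ) : matOf Θ * (matOf Θ)ᴴ = 1 := by
  rw [mul_eq_one_comm]
  ext i k
  have := h.antiunitary (EuclideanSpace.single i (1 : ℂ)) (EuclideanSpace.single k 1)
  rw [inner_eq_sum] at this
  simp only [Matrix.mul_apply, Matrix.conjTranspose_apply, matOf, Matrix.of_apply]
  rw [this]
  simp [EuclideanSpace.inner_single_left, Matrix.one_apply, apply_ite, eq_comm]

/-- The bilinear form `∑ S_{ij} φ_{0i} ψ_{1j}` on `ℂ² ⊗ ℂⁿ`. -/
def rowForm [Fintype n] (S : Matrix n n ℂ) (φ : Ket (Fin 2 × n)) : ℂ :=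
  ∑ i, ∑ j, S i j * (φ (0, i) * φ (1, j))

/-- An antisymmetric 2 × 2 matrix has one free entry, so Θ_A enters only through a scalar.
Antisymmetry of Θ_B makes the two surviving blocks equal, whence the factor 2. -/
theorem inner_antiTensor [Fintype n] [DecidableEq n] {ΘA : AntiLin (Fin 2)} {ΘB : AntiLin n}
    (hA : IsSkewConjugation ΘA) (hB : IsSkewConjugation ΘB) (φ : Ket (Fin 2 × n)) :
    inner ℂ φ (antiTensor ΘA ΘB φ) =
      2 * matOf ΘA 0 1 * star (rowForm ((matOf ΘB).map star) φ) := by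
  have hA' := matOf_transpose hA
  have hB' := matOf_transpose hB
  have a00 : matOf ΘA 0 0 = 0 := by
    have := congrFun (congrFun hA' 0) 0
    exact self_eq_neg.1 this
  have a11 : matOf ΘA 1 1 = 0 := by
    have := congrFun (congrFun hA' 1) 1
    exact self_eq_neg.1 this
  have a10 : matOf ΘA 1 0 = -matOf ΘA 0 1 := congrFun (congrFun hA' 0) 1
  have hb : ∀ i j, matOf ΘB j i = -matOf ΘB i j := fun i j => congrFun (congrFun hB' i) j
  have h1 : inner ℂ φ (antiTensor ΘA ΘB φ) = ∑ k, ∑ l, ∑ i, ∑ j,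
      star (φ (k, l)) * (star (φ (i, j)) * (matOf ΘA k i * matOf ΘB l j)) := by
    rw [inner_eq_sum, Fintype.sum_prod_type]
    refine Finset.sum_congr rfl fun k _ => Finset.sum_congr rfl fun l _ => ?_
    simp [antiTensor, prodKet, matOf, ← Finset.mul_sum, mul_add]
  rw [h1]
  simp only [Fin.sum_univ_two, a00, a11, a10, zero_mul, mul_zero, Finset.sum_const_zero, zero_add,
    add_zero, rowForm, star_sum, star_mul', Matrix.map_apply, star_star]
  have h2 : ∑ l, ∑ j, star (φ (1, l)) * (star (φ (0, j)) * (-matOf ΘA 0 1 * matOf ΘB l j)) =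
      ∑ l, ∑ j, star (φ (0, l)) * (star (φ (1, j)) * (matOf ΘA 0 1 * matOf ΘB l j)) := by
    rw [Finset.sum_comm]
    refine Finset.sum_congr rfl fun k _ => Finset.sum_congr rfl fun l _ => ?_
    rw [hb k l]
    ring
  rw [h2, ← two_mul, mul_assoc]
  congr 1
  rw [Finset.mul_sum]
  refine Finset.sum_congr rfl fun k _ => ?_
  rw [Finset.mul_sum]
  refine Finset.sum_congr rfl fun l _ => ?_
  ring

/-- For every unitary antisymmetric `S` the state has an ensemble of isotropic vectors of the
associated quadratic form. -/
def IsRowIsotropic (ρ : Matrix (Fin 2 × Fin 4) (Fin 2 × Fin 4) ℂ) : Prop :=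
  ∀ S : Matrix (Fin 4) (Fin 4) ℂ, Sᵀ = -S → S * Sᴴ = 1 →
    ∃ (N : ℕ) (μ : Fin N → ℝ) (φ : Fin N → Ket (Fin 2 × Fin 4)),
      IsEnsemble μ φ ρ ∧ ∀ j, rowForm S (φ j) = 0

theorem conj_mul_conjTranspose [Fintype n] [DecidableEq n] {S : Matrix n n ℂ}
    (h : S * Sᴴ = 1) : S.map star * (S.map star)ᴴ = 1 := by
  have h2 : S.map star * (S.map star)ᴴ = (S * Sᴴ).map star := by
    ext i j
    simp [Matrix.mul_apply]
  rw [h2, h]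
  ext i j
  simp [Matrix.one_apply, apply_ite]

/-- Zero is always a lower bound, and a sum of nonnegative terms with positive weights vanishes only
if each concurrence does. Conjugating the matrix of Θ_B is harmless, as it preserves antisymmetry
and unitarity. -/
theorem isZC_iff {ρ : Matrix (Fin 2 × Fin 4) (Fin 2 × Fin 4) ℂ} :
    IsZC ρ ↔ IsRowIsotropic ρ := by
  constructor
  · intro h S hS hU
    have hB : IsSkewConjugation (matAntiLin (S.map star)) := by
      refine isSkewConjugation_matAntiLin ?_ (conj_mul_conjTranspose hU)
      ext i j
      have := congrFun (congrFun hS i) j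
      simp only [Matrix.transpose_apply, Matrix.neg_apply] at this
      simp [this]
    have hA : IsSkewConjugation (matAntiLin !![0, 1; -1, 0] : AntiLin (Fin 2)) := by
      refine isSkewConjugation_matAntiLin ?_ ?_
      · ext i j
        fin_cases i <;> fin_cases j <;> simp
      · ext i j
        fin_cases i <;> fin_cases j <;> simp [Matrix.mul_apply]
    obtain ⟨⟨N, μ, φ, hμ, hs, hn, hρ, h0⟩, -⟩ := h _ _ hA hB
    refine ⟨N, μ, φ, ⟨hμ, hs, hn, hρ⟩, fun j => ?_⟩
    have h1 := (Finset.sum_eq_zero_iff_of_nonneg fun k _ =>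
      mul_nonneg (hμ k).le (norm_nonneg _)).1 h0.symm j (Finset.mem_univ _)
    have h2 : inner ℂ (φ j) (antiTensor (matAntiLin !![0, 1; -1, 0] : AntiLin (Fin 2))
        (matAntiLin (S.map star)) (φ j)) = (0 : ℂ) := by
      simpa [(hμ j).ne', pureConcurrence] using h1
    rw [inner_antiTensor hA hB] at h2
    have h3 : (matOf (matAntiLin (S.map star))).map star = S := by
      ext i j
      simp [matOf, matAntiLin_single]
    have h4 : matOf (matAntiLin !![0, 1; -1, 0] : AntiLin (Fin 2)) 0 1 = 1 := by
      simp [matOf, matAntiLin_single]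
    rw [h3, h4] at h2
    simpa using h2
  · intro h ΘA ΘB hA hB
    obtain ⟨N, μ, φ, he, h0⟩ := h ((matOf ΘB).map star) (by
      ext i j
      have := congrFun (congrFun (matOf_transpose hB) i) j
      simp only [Matrix.transpose_apply, Matrix.neg_apply] at this
      simp [this]) (conj_mul_conjTranspose (matOf_mul_conjTranspose hB))
    refine ⟨⟨N, μ, φ, he.pos, he.sum_eq_one, he.norm_eq_one, he.eq_sum, ?_⟩, ?_⟩
    · refine (Finset.sum_eq_zero fun j _ => ?_).symm
      rw [pureConcurrence, inner_antiTensor hA hB, h0]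
      simp
    · rintro c ⟨N, μ, φ, hμ, -, -, -, rfl⟩
      exact Finset.sum_nonneg fun j _ => mul_nonneg (hμ j).le (norm_nonneg _)

theorem rowForm_smul [Fintype n] (c : ℂ) (S : Matrix n n ℂ) (φ : Ket (Fin 2 × n)) :
    rowForm (c • S) φ = c * rowForm S φ := by
  simp only [rowForm, Finset.mul_sum, Matrix.smul_apply, smul_eq_mul, mul_assoc]

/-- A variant without normalization. -/
theorem IsRowIsotropic.of_smul {ρ : Matrix (Fin 2 × Fin 4) (Fin 2 × Fin 4) ℂ}
    (h : IsRowIsotropic ρ) {S : Matrix (Fin 4) (Fin 4) ℂ} (hS : Sᵀ = -S) {r : ℝ} (hr : 0 < r)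
    (hU : S * Sᴴ = (r : ℂ) • 1) :
    ∃ (N : ℕ) (μ : Fin N → ℝ) (φ : Fin N → Ket (Fin 2 × Fin 4)),
      IsEnsemble μ φ ρ ∧ ∀ j, rowForm S (φ j) = 0 := by
  have hc : ((Real.sqrt r)⁻¹ : ℂ) ≠ 0 := inv_ne_zero (by exact_mod_cast (Real.sqrt_pos.2 hr).ne')
  obtain ⟨N, μ, φ, he, h0⟩ := h ((((Real.sqrt r)⁻¹ : ℝ) : ℂ) • S)
    (by rw [Matrix.transpose_smul, hS, smul_neg]) (by
      rw [Matrix.conjTranspose_smul, Matrix.smul_mul, Matrix.mul_smul, hU, smul_smul, smul_smul,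
        Complex.star_def, Complex.conj_ofReal, ← Complex.ofReal_mul, ← Complex.ofReal_mul,
        ← mul_inv_rev, Real.mul_self_sqrt hr.le, inv_mul_cancel₀ hr.ne', Complex.ofReal_one,
        one_smul])
  refine ⟨N, μ, φ, he, fun j => ?_⟩
  have := h0 j
  rw [rowForm_smul] at this
  exact (mul_eq_zero.1 this).resolve_left (by simpa using hc)

/-- The form xᵀSy is alternating in the two rows, so mixing the rows by X multiplies it by det X,
while Y acts by congruence on S. -/
theorem rowForm_mulKet [Fintype n] {S : Matrix n n ℂ} (hS : Sᵀ = -S)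
    (X : Matrix (Fin 2) (Fin 2) ℂ) (Y : Matrix n n ℂ) (φ : Ket (Fin 2 × n)) :
    rowForm S (mulKet (X ⊗ₖ Y) φ) = X.det * rowForm (Yᵀ * S * Y) φ := by
  set x : n → ℂ := fun i => φ (0, i) with hx
  set y : n → ℂ := fun i => φ (1, i) with hy
  have hform : ∀ (T : Matrix n n ℂ) (ψ : Ket (Fin 2 × n)),
      rowForm T ψ = (fun i => ψ (0, i)) ⬝ᵥ T *ᵥ (fun i => ψ (1, i)) := fun T ψ => by
    simp only [rowForm, dotProduct, Matrix.mulVec, Finset.mul_sum]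
    exact Finset.sum_congr rfl fun i _ => Finset.sum_congr rfl fun j _ => by ring
  have hrow : ∀ k : Fin 2, (fun i => mulKet (X ⊗ₖ Y) φ (k, i)) =
      Y *ᵥ (X k 0 • x + X k 1 • y) := fun k => by
    ext i
    simp only [mulKet_apply, Fintype.sum_prod_type, Fin.sum_univ_two, Matrix.kroneckerMap_apply,
      Matrix.mulVec, dotProduct, Pi.add_apply, Pi.smul_apply, smul_eq_mul, hx, hy]
    rw [← Finset.sum_add_distrib]
    exact Finset.sum_congr rfl fun j _ => by ring
  set T := Yᵀ * S * Y with hT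
  have hTt : Tᵀ = -T := by
    simp [hT, hS, Matrix.mul_assoc]
  have hanti : ∀ u v : n → ℂ, u ⬝ᵥ T *ᵥ v = -(v ⬝ᵥ T *ᵥ u) := fun u v => by
    rw [Matrix.dotProduct_mulVec, ← Matrix.mulVec_transpose, hTt, Matrix.neg_mulVec,
      neg_dotProduct, dotProduct_comm]
  have hself : ∀ u : n → ℂ, u ⬝ᵥ T *ᵥ u = 0 := fun u => self_eq_neg.1 (hanti u u)
  have hYT : ∀ u v : n → ℂ, (Y *ᵥ u) ⬝ᵥ S *ᵥ (Y *ᵥ v) = u ⬝ᵥ T *ᵥ v := fun u v => by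
    rw [hT, ← Matrix.mulVec_mulVec, ← Matrix.mulVec_mulVec, Matrix.dotProduct_mulVec u,
      Matrix.vecMul_transpose]
  rw [hform, hrow, hrow, hYT, hform, ← hx, ← hy, Matrix.det_fin_two]
  simp only [Matrix.mulVec_add, Matrix.mulVec_smul, dotProduct_add, add_dotProduct,
    dotProduct_smul, smul_dotProduct, smul_eq_mul, hself, hanti y x]
  ring

theorem IsRowIsotropic.map {ρ : Matrix (Fin 2 × Fin 4) (Fin 2 × Fin 4) ℂ}
    (h : IsRowIsotropic ρ) {X : Matrix (Fin 2) (Fin 2) ℂ} {Y : Matrix (Fin 4) (Fin 4) ℂ}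
    (hX : X ∈ Matrix.unitaryGroup (Fin 2) ℂ) (hY : Y ∈ Matrix.unitaryGroup (Fin 4) ℂ) :
    IsRowIsotropic ((X ⊗ₖ Y) * ρ * (X ⊗ₖ Y)ᴴ) := by
  intro S hS hU
  have hX' : Xᴴ * X = 1 := Matrix.mem_unitaryGroup_iff'.1 hX
  have hY' : Yᴴ * Y = 1 := Matrix.mem_unitaryGroup_iff'.1 hY
  obtain ⟨N, μ, φ, he, h0⟩ := h (Yᵀ * S * Y) (by simp [hS, Matrix.mul_assoc]) (by
    have hmem : Yᵀ * S * Y ∈ Matrix.unitaryGroup (Fin 4) ℂ :=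
      mul_mem (mul_mem (Matrix.transpose_mem_unitaryGroup_iff.2 hY)
        (Matrix.mem_unitaryGroup_iff.2 hU)) hY
    exact Matrix.mem_unitaryGroup_iff.1 hmem)
  refine ⟨N, μ, _, he.map (kronecker_isometry hX' hY'), fun j => ?_⟩
  rw [rowForm_mulKet hS, h0, mul_zero]

end SkewForms

/-! ### Local unitaries and their phases -/

section LocalTransform

theorem localTransform_eq (X : Matrix (Fin 2) (Fin 2) ℂ) (Y : Matrix (Fin 4) (Fin 4) ℂ)
    (ρ : Matrix (Fin 2 × Fin 4) (Fin 2 × Fin 4) ℂ) :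
    localTransform X Y ρ = (X ⊗ₖ Y) * ρ * (X ⊗ₖ Y)ᴴ := by
  rw [localTransform, Matrix.conjTranspose_kronecker]

theorem localTransform_localTransform (X X' : Matrix (Fin 2) (Fin 2) ℂ)
    (Y Y' : Matrix (Fin 4) (Fin 4) ℂ) (ρ : Matrix (Fin 2 × Fin 4) (Fin 2 × Fin 4) ℂ) :
    localTransform X' Y' (localTransform X Y ρ) = localTransform (X' * X) (Y' * Y) ρ := by
  simp only [localTransform_eq, Matrix.mul_kronecker_mul, Matrix.conjTranspose_mul,
    Matrix.mul_assoc]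

theorem localTransform_star_self {X : Matrix (Fin 2) (Fin 2) ℂ} {Y : Matrix (Fin 4) (Fin 4) ℂ}
    (hX : X ∈ Matrix.unitaryGroup (Fin 2) ℂ) (hY : Y ∈ Matrix.unitaryGroup (Fin 4) ℂ)
    (ρ : Matrix (Fin 2 × Fin 4) (Fin 2 × Fin 4) ℂ) :
    localTransform (star X) (star Y) (localTransform X Y ρ) = ρ := by
  rw [localTransform_localTransform, Matrix.mem_unitaryGroup_iff'.1 hX,
    Matrix.mem_unitaryGroup_iff'.1 hY]
  simp [localTransform]

theorem localTransform_smul_smul {c d : ℂ} (hc : ‖c‖ = 1) (hd : ‖d‖ = 1)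
    (X : Matrix (Fin 2) (Fin 2) ℂ) (Y : Matrix (Fin 4) (Fin 4) ℂ)
    (ρ : Matrix (Fin 2 × Fin 4) (Fin 2 × Fin 4) ℂ) :
    localTransform (c • X) (d • Y) ρ = localTransform X Y ρ := by
  have h : ∀ z : ℂ, ‖z‖ = 1 → z * star z = 1 := fun z hz => by
    rw [Complex.star_def, Complex.mul_conj, Complex.normSq_eq_norm_sq, hz]
    simp
  simp only [localTransform, Matrix.conjTranspose_smul, Matrix.smul_kronecker,
    Matrix.kronecker_smul, Matrix.smul_mul, Matrix.mul_smul, smul_smul]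
  rw [show star d * star c * (d * c) = (c * star c) * (d * star d) by ring, h c hc, h d hd,
    one_mul, one_smul]

/-- A unitary matrix is special unitary up to a phase. -/
theorem exists_smul_mem_specialUnitaryGroup {n : Type*} [Fintype n] [DecidableEq n] [Nonempty n]
    {X : Matrix n n ℂ} (hX : X ∈ Matrix.unitaryGroup n ℂ) :
    ∃ c : ℂ, ‖c‖ = 1 ∧ c • X ∈ Matrix.specialUnitaryGroup n ℂ := by
  have hdet : ‖X.det‖ = 1 := by
    have := Matrix.det_of_mem_unitary hX
    have h2 := (Unitary.mem_iff.1 this).2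
    rw [Complex.star_def, Complex.mul_conj, Complex.normSq_eq_norm_sq] at h2
    have h3 : ‖X.det‖ ^ 2 = 1 := by exact_mod_cast h2
    nlinarith [norm_nonneg X.det]
  have hpos : 0 < Fintype.card n := Fintype.card_pos
  obtain ⟨c, hc⟩ := IsAlgClosed.exists_pow_nat_eq (X.det)⁻¹ hpos
  have hc1 : ‖c‖ = 1 := by
    have h4 : ‖c‖ ^ Fintype.card n = 1 := by rw [← norm_pow, hc, norm_inv, hdet, inv_one]
    exact (pow_eq_one_iff_of_nonneg (norm_nonneg c) hpos.ne').1 h4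
  refine ⟨c, hc1, Matrix.mem_specialUnitaryGroup_iff.2 ⟨?_, ?_⟩⟩
  · rw [Matrix.mem_unitaryGroup_iff] at hX ⊢
    rw [star_smul, Matrix.smul_mul, Matrix.mul_smul, hX, smul_smul, Complex.star_def,
      Complex.mul_conj, Complex.normSq_eq_norm_sq, hc1]
    simp
  · rw [Matrix.det_smul, hc]
    exact inv_mul_cancel₀ (norm_ne_zero_iff.1 (by rw [hdet]; exact one_ne_zero))

/-- Phases cancel in the conjugation of ρ, so normal forms may be sought with arbitrary unitaries.
-/
theorem exists_specialUnitary_localTransform {X : Matrix (Fin 2) (Fin 2) ℂ}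
    {Y : Matrix (Fin 4) (Fin 4) ℂ} (hX : X ∈ Matrix.unitaryGroup (Fin 2) ℂ)
    (hY : Y ∈ Matrix.unitaryGroup (Fin 4) ℂ) :
    ∃ X' ∈ Matrix.specialUnitaryGroup (Fin 2) ℂ, ∃ Y' ∈ Matrix.specialUnitaryGroup (Fin 4) ℂ,
      ∀ ρ, localTransform X' Y' ρ = localTransform X Y ρ := by
  obtain ⟨c, hc, hcX⟩ := exists_smul_mem_specialUnitaryGroup hX
  obtain ⟨d, hd, hdY⟩ := exists_smul_mem_specialUnitaryGroup hY
  exact ⟨_, hcX, _, hdY, fun ρ => localTransform_smul_smul hc hd X Y ρ⟩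

end LocalTransform

/-! ### Binary quadratic forms and isotropic ensembles -/

section BinaryForms

/-- With T = [[a, b], [b, c]] and J = [[0, -1], [1, 0]], isotropy of v = (x, y) means Tv = kJv for v
≠ 0. The matrix J⁻¹T has trace zero, so k² = b² - ac and k = ±κ. What matters later is that the
ratio e = ±1 is real. -/
theorem exists_mul_of_isotropic {a b c x y κ : ℂ} (hκ : κ ^ 2 = b ^ 2 - a * c)
    (h : a * x ^ 2 + 2 * b * x * y + c * y ^ 2 = 0) :
    ∃ e : ℝ, a * x + b * y = -(κ * e * y) ∧ b * x + c * y = κ * e * x := by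
  have key : ∀ k : ℂ, a * x + b * y = -(k * y) → b * x + c * y = k * x → (x ≠ 0 ∨ y ≠ 0) →
      ∃ e : ℝ, a * x + b * y = -(κ * e * y) ∧ b * x + c * y = κ * e * x := by
    intro k h1 h2 hxy
    have h3 : k ^ 2 = κ ^ 2 := by
      rw [hκ]
      rcases hxy with hx | hy
      · have : (k ^ 2 - (b ^ 2 - a * c)) * x = 0 := by
          linear_combination c * h1 - (b + k) * h2
        exact sub_eq_zero.1 ((mul_eq_zero.1 this).resolve_right hx)
      · have : (k ^ 2 - (b ^ 2 - a * c)) * y = 0 := by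
          linear_combination (k - b) * h1 + a * h2
        exact sub_eq_zero.1 ((mul_eq_zero.1 this).resolve_right hy)
    rcases sq_eq_sq_iff_eq_or_eq_neg.1 h3 with rfl | rfl
    · exact ⟨1, by simpa using h1, by simpa using h2⟩
    · exact ⟨-1, by simpa using h1, by simpa using h2⟩
  by_cases hy : y = 0
  · by_cases hx : x = 0
    · exact ⟨1, by simp [hx, hy], by simp [hx, hy]⟩
    · have ha : a = 0 := by simpa [hy, hx] using h
      exact key b (by simp [ha, hy]) (by simp [hy]) (Or.inl hx)
  · refine key (-(a * x + b * y) / y) (by field_simp) ?_ (Or.inr hy)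
    field_simp
    linear_combination h

/-- If `diag(l₁, l₂)` is a mixture of isotropic vectors of a binary quadratic form, then the
matrix of the form is unitary up to scaling with respect to the weights `l₁`, `l₂`. -/
theorem normSq_eq_of_isotropic_mixture {a b c : ℂ} {l₁ l₂ : ℝ} (h₁ : l₁ ≠ 0)
    {N : ℕ} {μ : Fin N → ℝ} {x y : Fin N → ℂ}
    (hxx : ∑ j, (μ j : ℂ) * (x j * star (x j)) = l₁)
    (hyy : ∑ j, (μ j : ℂ) * (y j * star (y j)) = l₂)
    (hxy : ∑ j, (μ j : ℂ) * (x j * star (y j)) = 0)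
    (h : ∀ j, a * x j ^ 2 + 2 * b * x j * y j + c * y j ^ 2 = 0) :
    l₁ ^ 2 * Complex.normSq a = l₂ ^ 2 * Complex.normSq c ∧
      l₁ * a * star b + l₂ * b * star c = 0 := by
  obtain ⟨κ, hκ⟩ := IsAlgClosed.exists_pow_nat_eq (b ^ 2 - a * c) (n := 2) two_pos
  choose e he1 he2 using fun j => exists_mul_of_isotropic hκ (h j)
  have hyx : ∑ j, (μ j : ℂ) * (y j * star (x j)) = 0 := by
    have := congrArg star hxy
    rw [star_sum, star_zero] at this
    rw [← this]
    refine Finset.sum_congr rfl fun j _ => ?_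
    simp only [star_mul', Complex.star_def, Complex.conj_ofReal, Complex.conj_conj]
    ring
  -- g and k are entries of the Hermitian matrix H = ∑ μ e v v*. Summing Tv = κ e Jv against v*
  -- gives TΛ = κJH with Λ = diag(l₁, l₂); `ha`, `hb` and `hc` are three entries of this identity.
  set g : ℂ := ∑ j, (μ j : ℂ) * (e j * (x j * star (y j))) with hg
  set k : ℝ := ∑ j, μ j * (e j * Complex.normSq (x j)) with hk
  have hgs : star g = ∑ j, (μ j : ℂ) * (e j * (y j * star (x j))) := by
    rw [hg, star_sum]
    refine Finset.sum_congr rfl fun j _ => ?_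
    simp only [star_mul', Complex.star_def, Complex.conj_ofReal, Complex.conj_conj]
    ring
  have hks : (k : ℂ) = ∑ j, (μ j : ℂ) * (e j * (x j * star (x j))) := by
    rw [hk]
    push_cast
    refine Finset.sum_congr rfl fun j _ => ?_
    rw [Complex.star_def, Complex.mul_conj]
  have ha : a * l₁ = -(κ * star g) := by
    have : ∑ j, (μ j : ℂ) * ((a * x j + b * y j) * star (x j)) = -(κ * star g) := by
      rw [hgs, Finset.mul_sum, ← Finset.sum_neg_distrib]
      refine Finset.sum_congr rfl fun j _ => ?_
      rw [he1]
      ring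
    rw [← this, ← add_zero (a * l₁), ← mul_zero b, ← hyx, ← hxx, Finset.mul_sum, Finset.mul_sum,
      ← Finset.sum_add_distrib]
    exact Finset.sum_congr rfl fun j _ => by ring
  have hb : b * l₁ = κ * k := by
    have : ∑ j, (μ j : ℂ) * ((b * x j + c * y j) * star (x j)) = κ * k := by
      rw [hks, Finset.mul_sum]
      refine Finset.sum_congr rfl fun j _ => ?_
      rw [he2]
      ring
    rw [← this, ← add_zero (b * l₁), ← mul_zero c, ← hyx, ← hxx, Finset.mul_sum, Finset.mul_sum,
      ← Finset.sum_add_distrib]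
    exact Finset.sum_congr rfl fun j _ => by ring
  have hc : c * l₂ = κ * g := by
    have : ∑ j, (μ j : ℂ) * ((b * x j + c * y j) * star (y j)) = κ * g := by
      rw [hg, Finset.mul_sum]
      refine Finset.sum_congr rfl fun j _ => ?_
      rw [he2]
      ring
    rw [← this, ← zero_add (c * (l₂ : ℂ)), ← mul_zero b, ← hxy, ← hyy, Finset.mul_sum,
      Finset.mul_sum, ← Finset.sum_add_distrib]
    exact Finset.sum_congr rfl fun j _ => by ring
  constructor
  · have h1 := congrArg Complex.normSq ha
    have h2 := congrArg Complex.normSq hc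
    rw [Complex.star_def] at h1
    simp only [Complex.normSq_mul, Complex.normSq_neg, Complex.normSq_conj,
      Complex.normSq_ofReal] at h1 h2
    linarith
  · have h1 : (l₁ : ℂ) ≠ 0 := by exact_mod_cast h₁
    have hb' := congrArg star hb
    have hc' := congrArg star hc
    simp only [star_mul', Complex.star_def, Complex.conj_ofReal] at hb' hc' ha ⊢
    refine (mul_eq_zero.1 (?_ : (l₁ : ℂ) * _ = 0)).resolve_left h1
    linear_combination (l₁ * (starRingEnd ℂ) b) * ha - κ * (starRingEnd ℂ) g * hb' +
      l₁ * b * hc' + (starRingEnd ℂ) κ * (starRingEnd ℂ) g * hb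

/-- A binary quadratic form whose matrix is a multiple of a unitary matrix has an orthonormal pair
of isotropic vectors. -/
theorem exists_isotropic_pair {a b c : ℂ} (hac : Complex.normSq a = Complex.normSq c)
    (hb : a * star b + b * star c = 0) :
    ∃ α β : ℂ, Complex.normSq α + Complex.normSq β = 1 ∧
      a * α ^ 2 + 2 * b * α * β + c * β ^ 2 = 0 ∧
      a * star β ^ 2 - 2 * b * star β * star α + c * star α ^ 2 = 0 := by
  by_cases hc : c = 0
  · have ha : a = 0 := by simpa [hc] using hac
    exact ⟨1, 0, by simp, by simp [ha], by simp [hc]⟩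
  have hroot : ∃ t : ℂ, a + 2 * b * t + c * t ^ 2 = 0 := by
    obtain ⟨s, hs⟩ := IsAlgClosed.exists_pow_nat_eq (b ^ 2 - a * c) (n := 2) two_pos
    refine ⟨(s - b) / c, ?_⟩
    field_simp
    linear_combination hs
  obtain ⟨t, ht⟩ := hroot
  have hpos : 0 < 1 + Complex.normSq t := by
    have := Complex.normSq_nonneg t
    linarith
  set r : ℝ := (Real.sqrt (1 + Complex.normSq t))⁻¹ with hr
  have hr2 : r * r * (1 + Complex.normSq t) = 1 := by
    rw [hr, ← mul_inv, Real.mul_self_sqrt hpos.le, inv_mul_cancel₀ hpos.ne']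
  -- The first vector is (1, t) normalized. That (β̄, -ᾱ) is isotropic as well follows from the
  -- conjugated equation for t times a, rewritten by the two hypotheses.
  refine ⟨r, r * t, ?_, ?_, ?_⟩
  · rw [Complex.normSq_mul, Complex.normSq_ofReal]
    linarith
  · linear_combination (r : ℂ) ^ 2 * ht
  · have hconj := congrArg star ht
    have hac' : a * star a = c * star c := by
      rw [Complex.star_def, Complex.mul_conj, Complex.mul_conj, hac]
    have hc' : star c ≠ 0 := star_ne_zero.2 hc
    simp only [star_add, star_mul', star_pow, star_zero] at hconj
    have h2 : star (2 : ℂ) = 2 := by simp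
    have hrr : star (r : ℂ) = r := by simp
    rw [h2] at hconj
    refine (mul_eq_zero.1 (?_ : star c * _ = 0)).resolve_left hc'
    rw [star_mul', hrr]
    linear_combination (r : ℂ) ^ 2 * (a * hconj) - (r : ℂ) ^ 2 * hac'
      - 2 * (r : ℂ) ^ 2 * star t * hb

end BinaryForms

/-! ### Schmidt decomposition -/

section Schmidt

/-- Schmidt decomposition of a vector of `ℂ² ⊗ ℂ⁴` that is not a product vector. -/
theorem exists_schmidt {ψ : Ket (Fin 2 × Fin 4)} (hψ : ¬ IsProductKet ψ) :
    ∃ X ∈ Matrix.unitaryGroup (Fin 2) ℂ, ∃ Y ∈ Matrix.unitaryGroup (Fin 4) ℂ, ∃ q₁ q₆ : ℝ,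
      0 < q₁ ∧ 0 < q₆ ∧
      mulKet (X ⊗ₖ Y) ψ = (q₁ : ℂ) • basisKet 0 0 + (q₆ : ℂ) • basisKet 1 1 := by
  set M : Matrix (Fin 2) (Fin 4) ℂ := Matrix.of fun i j => ψ (i, j) with hM
  have hH : (M * Mᴴ).IsHermitian := Matrix.isHermitian_mul_conjTranspose_self M
  set U := hH.eigenvectorUnitary with hU
  set X : Matrix (Fin 2) (Fin 2) ℂ := star (U : Matrix (Fin 2) (Fin 2) ℂ) with hX
  have hXmem : X ∈ Matrix.unitaryGroup (Fin 2) ℂ := Unitary.star_mem U.2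
  have hUX : (U : Matrix (Fin 2) (Fin 2) ℂ) * X = 1 := Matrix.mem_unitaryGroup_iff.1 U.2
  set R : Fin 2 → Ket (Fin 4) := fun k => WithLp.toLp 2 fun j => (X * M) k j with hR
  have hdiag : (X * M) * (X * M)ᴴ = Matrix.diagonal (RCLike.ofReal ∘ hH.eigenvalues) := by
    rw [← hH.conjStarAlgAut_star_eigenvectorUnitary, Unitary.conjStarAlgAut_star_apply,
      Matrix.conjTranspose_mul, hX]
    simp only [Matrix.star_eq_conjTranspose, Matrix.conjTranspose_conjTranspose, Matrix.mul_assoc,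
      ← hU]
  have horth : ∀ k l, k ≠ l → inner ℂ (R k) (R l) = (0 : ℂ) := fun k l hkl => by
    have := congrFun (congrFun hdiag l) k
    rw [Matrix.diagonal_apply_ne _ hkl.symm] at this
    rw [← this, inner_eq_sum, Matrix.mul_apply]
    exact Finset.sum_congr rfl fun j _ => mul_comm _ _
  have hψR : ∀ i j, ψ (i, j) = ∑ k, (U : Matrix (Fin 2) (Fin 2) ℂ) i k * R k j := fun i j => by
    have : M = (U : Matrix (Fin 2) (Fin 2) ℂ) * (X * M) := by
      rw [← Matrix.mul_assoc, hUX, Matrix.one_mul]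
    have h2 := congrFun (congrFun this i) j
    rw [Matrix.mul_apply] at h2
    exact h2
  -- After diagonalizing M Mᴴ the rows of X M are orthogonal; were one of them zero, ψ would be a
  -- product built from the other.
  have hne : ∀ k, R k ≠ 0 := fun k h0 => by
    refine hψ ⟨WithLp.toLp 2 fun i => (U : Matrix (Fin 2) (Fin 2) ℂ) i (1 - k), R (1 - k), ?_⟩
    ext ⟨i, j⟩
    rw [hψR]
    fin_cases k
    · simp only [Fin.zero_eta] at h0
      simp [Fin.sum_univ_two, h0, prodKet]
    · simp only [Fin.mk_one] at h0
      simp [Fin.sum_univ_two, h0, prodKet]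
  have hq : ∀ k, 0 < ‖R k‖ := fun k => norm_pos_iff.2 (hne k)
  -- The last two entries are placeholders: the orthonormal family is extended from the indices 0
  -- and 1 only.
  set v : Fin 4 → Ket (Fin 4) :=
    ![((‖R 0‖ : ℂ)⁻¹) • R 0, ((‖R 1‖ : ℂ)⁻¹) • R 1, 0, 0] with hv
  have hon : Orthonormal ℂ (({0, 1} : Set (Fin 4)).domRestrict v) := by
    have hn : ∀ k, ‖((‖R k‖ : ℂ)⁻¹) • R k‖ = 1 := fun k => by
      rw [norm_smul, norm_inv, Complex.norm_real, norm_norm, inv_mul_cancel₀ (hq k).ne']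
    have ho : ∀ k l, k ≠ l →
        inner ℂ (((‖R k‖ : ℂ)⁻¹) • R k) (((‖R l‖ : ℂ)⁻¹) • R l) = (0 : ℂ) := fun k l hkl => by
      rw [inner_smul_left, inner_smul_right, horth k l hkl]
      simp
    constructor
    · rintro ⟨i, hi⟩
      rcases hi with rfl | rfl
      · exact hn 0
      · exact hn 1
    · rintro ⟨i, hi⟩ ⟨j, hj⟩ hij
      rcases hi with rfl | rfl <;> rcases hj with rfl | rfl
      · exact absurd rfl hij
      · exact ho 0 1 (by decide)
      · exact ho 1 0 (by decide)
      · exact absurd rfl hij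
  obtain ⟨b, hb⟩ := hon.exists_orthonormalBasis_extension_of_card_eq (by simp)
  have hb0 : R 0 = (‖R 0‖ : ℂ) • b 0 := by
    rw [hb 0 (by simp), hv]
    simp [smul_smul, hne 0]
  have hb1 : R 1 = (‖R 1‖ : ℂ) • b 1 := by
    rw [hb 1 (by simp), hv]
    simp [smul_smul, hne 1]
  set Y : Matrix (Fin 4) (Fin 4) ℂ := Matrix.of fun k j => star (b k j) with hY
  have hYb : ∀ k l, ∑ j, Y k j * b l j = if k = l then 1 else 0 := fun k l => by
    rw [← orthonormal_iff_ite.1 b.orthonormal k l, inner_eq_sum]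
    rfl
  have hYmem : Y ∈ Matrix.unitaryGroup (Fin 4) ℂ := by
    rw [Matrix.mem_unitaryGroup_iff]
    ext k l
    rw [Matrix.mul_apply, Matrix.one_apply, ← hYb k l]
    simp [hY]
  refine ⟨X, hXmem, Y, hYmem, ‖R 0‖, ‖R 1‖, hq 0, hq 1, ?_⟩
  ext ⟨k, l⟩
  have hl : mulKet (X ⊗ₖ Y) ψ (k, l) = ∑ j, Y l j * R k j := by
    rw [mulKet_apply, Fintype.sum_prod_type, Finset.sum_comm]
    refine Finset.sum_congr rfl fun j _ => ?_
    simp only [hR, Matrix.mul_apply, Finset.mul_sum, Matrix.kroneckerMap_apply, hM, Matrix.of_apply]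
    exact Finset.sum_congr rfl fun i _ => by ring
  rw [hl]
  have h3 : ∀ (c : ℂ) (m : Fin 4), ∑ j, Y l j * (c • b m) j = if l = m then c else 0 :=
    fun c m => by
      have : ∑ j, Y l j * (c • b m) j = c * ∑ j, Y l j * b m j := by
        rw [Finset.mul_sum]
        refine Finset.sum_congr rfl fun j _ => ?_
        simp only [PiLp.smul_apply, smul_eq_mul]
        ring
      rw [this, hYb]
      simp
  fin_cases k
  · simp only [Fin.zero_eta]
    rw [hb0, h3]
    simp [basisKet, prodKet, norm_smul]
  · simp only [Fin.mk_one]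
    rw [hb1, h3]
    simp [basisKet, prodKet, norm_smul]

end Schmidt

/-! ### Skew forms on the range and the test family -/

section Polar

/-- The polarization of `rowForm`. -/
def rowPolar (S : Matrix (Fin 4) (Fin 4) ℂ) (φ ψ : Ket (Fin 2 × Fin 4)) : ℂ :=
  ∑ i, ∑ j, S i j * (φ (0, i) * ψ (1, j) + ψ (0, i) * φ (1, j))

theorem rowForm_add (S : Matrix (Fin 4) (Fin 4) ℂ) (z w : ℂ) (φ ψ : Ket (Fin 2 × Fin 4)) :
    rowForm S (z • φ + w • ψ) =
      rowForm S φ * z ^ 2 + rowPolar S φ ψ * z * w + rowForm S ψ * w ^ 2 := by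
  simp only [rowForm, rowPolar, Finset.sum_mul, ← Finset.sum_add_distrib, PiLp.add_apply,
    PiLp.smul_apply, smul_eq_mul]
  exact Finset.sum_congr rfl fun i _ => Finset.sum_congr rfl fun j _ => by ring

/-- The two relations satisfied by the matrix of a skew form restricted to the range of a state
having an ensemble of isotropic vectors. -/
theorem IsEnsemble.rowForm_relations {ρ : Matrix (Fin 2 × Fin 4) (Fin 2 × Fin 4) ℂ} {lam : ℝ}
    {ψ₁ ψ₂ : Ket (Fin 2 × Fin 4)} {N : ℕ} {μ : Fin N → ℝ} {φ : Fin N → Ket (Fin 2 × Fin 4)}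
    (he : IsEnsemble μ φ ρ) (h : IsSpectralForm lam ψ₁ ψ₂ ρ) {S : Matrix (Fin 4) (Fin 4) ℂ}
    (hS : ∀ j, rowForm S (φ j) = 0) :
    lam ^ 2 * Complex.normSq (rowForm S ψ₁) = (1 - lam) ^ 2 * Complex.normSq (rowForm S ψ₂) ∧
      lam * rowForm S ψ₁ * star (rowPolar S ψ₁ ψ₂) +
        ((1 - lam : ℝ) : ℂ) * rowPolar S ψ₁ ψ₂ * star (rowForm S ψ₂) = 0 := by
  have i11 := (norm_eq_one_iff_inner _).1 h.norm_fst
  have i22 := (norm_eq_one_iff_inner _).1 h.norm_snd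
  have i12 := h.orthogonal
  have i21 := inner_eq_zero_symm.1 h.orthogonal
  have hst : ∀ (ψ : Ket (Fin 2 × Fin 4)) j, star (inner ℂ ψ (φ j) : ℂ) = inner ℂ (φ j) ψ :=
    fun ψ j => inner_conj_symm _ _
  -- The polarization is twice the off-diagonal entry of the form's matrix, hence the division by 2.
  have key := normSq_eq_of_isotropic_mixture (a := rowForm S ψ₁) (b := rowPolar S ψ₁ ψ₂ / 2)
    (c := rowForm S ψ₂) (l₂ := 1 - lam) (μ := μ) (x := fun j => inner ℂ ψ₁ (φ j))
    (y := fun j => inner ℂ ψ₂ (φ j)) h.lam_pos.ne'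
    (by simp only [hst]; rw [he.sum_inner_eq_of_isSpectralForm h, i11, i12]; ring)
    (by simp only [hst]; rw [he.sum_inner_eq_of_isSpectralForm h, i22, i21]; ring)
    (by simp only [hst]; rw [he.sum_inner_eq_of_isSpectralForm h, i12]; ring)
    (fun j => by
      have := hS j
      rw [he.eq_add_of_isSpectralForm h j, rowForm_add] at this
      rw [← this]
      ring)
  refine ⟨key.1, ?_⟩
  have h2 := key.2
  rw [star_div₀, show star (2 : ℂ) = 2 by simp] at h2
  linear_combination 2 * h2

/-- The skew forms that are unitary up to a positive factor. -/
def skewMat (s t u : ℂ) : Matrix (Fin 4) (Fin 4) ℂ :=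
  !![0, s, t, u; -s, 0, star u, -star t; -t, -star u, 0, star s; -u, star t, -star s, 0]

theorem skewMat_transpose (s t u : ℂ) : (skewMat s t u)ᵀ = -skewMat s t u := by
  ext i j
  fin_cases i <;> fin_cases j <;> simp [skewMat]

/-- Entries at complementary index pairs are conjugate up to sign, which makes the rows orthogonal
and of equal norm. -/
theorem skewMat_mul_conjTranspose (s t u : ℂ) : skewMat s t u * (skewMat s t u)ᴴ =
    ((Complex.normSq s + Complex.normSq t + Complex.normSq u : ℝ) : ℂ) • 1 := by
  have hs := Complex.mul_conj s
  have ht := Complex.mul_conj t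
  have hu := Complex.mul_conj u
  ext i j
  fin_cases i <;> fin_cases j <;>
    simp [skewMat, Matrix.mul_apply, Fin.sum_univ_four, ← hs, ← ht, ← hu] <;> ring

theorem rowForm_skewMat (s t u : ℂ) (φ : Ket (Fin 2 × Fin 4)) : rowForm (skewMat s t u) φ =
    s * (φ (0, 0) * φ (1, 1) - φ (0, 1) * φ (1, 0)) +
    t * (φ (0, 0) * φ (1, 2) - φ (0, 2) * φ (1, 0)) +
    u * (φ (0, 0) * φ (1, 3) - φ (0, 3) * φ (1, 0)) +
    star u * (φ (0, 1) * φ (1, 2) - φ (0, 2) * φ (1, 1)) -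
    star t * (φ (0, 1) * φ (1, 3) - φ (0, 3) * φ (1, 1)) +
    star s * (φ (0, 2) * φ (1, 3) - φ (0, 3) * φ (1, 2)) := by
  simp [rowForm, skewMat, Fin.sum_univ_four]
  ring

theorem schmidt_apply (q₁ q₆ : ℂ) (p : Fin 2 × Fin 4) :
    (q₁ • basisKet 0 0 + q₆ • basisKet 1 1) p =
      if p = (0, 0) then q₁ else if p = (1, 1) then q₆ else 0 := by
  obtain ⟨i, j⟩ := p
  fin_cases i <;> fin_cases j <;> simp [basisKet, prodKet]

theorem shifted_schmidt_apply (q₁ q₆ : ℂ) (p : Fin 2 × Fin 4) :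
    (q₁ • basisKet 0 2 + q₆ • basisKet 1 3) p =
      if p = (0, 2) then q₁ else if p = (1, 3) then q₆ else 0 := by
  obtain ⟨i, j⟩ := p
  fin_cases i <;> fin_cases j <;> simp [basisKet, prodKet]

theorem rowForm_schmidt (S : Matrix (Fin 4) (Fin 4) ℂ) (q₁ q₆ : ℂ) :
    rowForm S (q₁ • basisKet 0 0 + q₆ • basisKet 1 1) = q₁ * q₆ * S 0 1 := by
  simp [rowForm, schmidt_apply, -PiLp.add_apply, -WithLp.ofLp_add]
  ring

theorem rowPolar_schmidt (S : Matrix (Fin 4) (Fin 4) ℂ) (q₁ q₆ : ℂ) (ψ : Ket (Fin 2 × Fin 4)) :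
    rowPolar S (q₁ • basisKet 0 0 + q₆ • basisKet 1 1) ψ =
      q₁ * ∑ j, S 0 j * ψ (1, j) + q₆ * ∑ i, S i 1 * ψ (0, i) := by
  simp [rowPolar, schmidt_apply, Fin.sum_univ_four, -PiLp.add_apply, -WithLp.ofLp_add]
  ring

theorem rowForm_shifted_schmidt (S : Matrix (Fin 4) (Fin 4) ℂ) (q₁ q₆ : ℂ) :
    rowForm S (q₁ • basisKet 0 2 + q₆ • basisKet 1 3) = q₁ * q₆ * S 2 3 := by
  simp [rowForm, shifted_schmidt_apply, -PiLp.add_apply, -WithLp.ofLp_add]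
  ring

theorem rowPolar_schmidt_shifted_schmidt (S : Matrix (Fin 4) (Fin 4) ℂ) (q₁ q₆ r₁ r₆ : ℂ) :
    rowPolar S (q₁ • basisKet 0 0 + q₆ • basisKet 1 1) (r₁ • basisKet 0 2 + r₆ • basisKet 1 3) =
      q₁ * r₆ * S 0 3 + q₆ * r₁ * S 2 1 := by
  rw [rowPolar_schmidt]
  simp [shifted_schmidt_apply, -PiLp.add_apply, -WithLp.ofLp_add]
  ring

end Polar

/-! ### The class ZCE: vanishing concurrences and entanglement -/

section ZCE

variable {ρ : Matrix (Fin 2 × Fin 4) (Fin 2 × Fin 4) ℂ} {q₁ q₆ φ : ℝ}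

/-- With both eigenvalues 1/2, every orthonormal basis of the range is an ensemble, so an
orthonormal isotropic pair suffices. Its existence is read off from the orthonormality of the rows
of S. -/
theorem rowIsotropic_of_canonical
    (h : IsCanonicalForm (1 / 2) q₁ q₆
      ((q₁ : ℂ) • basisKet 0 2 + ((q₆ : ℂ) * Complex.exp (Complex.I * φ)) • basisKet 1 3) ρ) :
    IsRowIsotropic ρ := by
  intro S hS hU
  set e := Complex.exp (Complex.I * φ) with he
  have hee : e * star e = 1 := by
    rw [Complex.star_def, Complex.mul_conj, Complex.normSq_eq_norm_sq, he, mul_comm Complex.I,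
      Complex.norm_exp_ofReal_mul_I]
    simp
  set ψ₁ : Ket (Fin 2 × Fin 4) := (q₁ : ℂ) • basisKet 0 0 + (q₆ : ℂ) • basisKet 1 1 with hψ₁
  set ψ₂ : Ket (Fin 2 × Fin 4) := (q₁ : ℂ) • basisKet 0 2 + ((q₆ : ℂ) * e) • basisKet 1 3 with hψ₂
  have hsk : ∀ i j, S j i = -S i j := fun i j => congrFun (congrFun hS i) j
  have hrow : ∀ i j, ∑ k, S i k * star (S j k) = if i = j then 1 else 0 := fun i j => by
    have := congrFun (congrFun hU i) j
    rwa [Matrix.mul_apply, Matrix.one_apply] at this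
  have hd : ∀ i, S i i = 0 := fun i => self_eq_neg.1 (hsk i i)
  have n0 := hrow 0 0
  have n1 := hrow 1 1
  have n2 := hrow 2 2
  have n3 := hrow 3 3
  have hrow0 : ∀ i j, i ≠ j → ∑ k, S i k * star (S j k) = 0 := fun i j hij => by
    rw [hrow, if_neg hij]
  have o02 := hrow0 0 2 (by decide)
  have o13 := hrow0 1 3 (by decide)
  simp only [Fin.sum_univ_four, hd, hsk 0 1, hsk 0 2, hsk 0 3, hsk 1 2, hsk 1 3, hsk 2 3, star_neg,
    star_zero, mul_zero, zero_mul, zero_add, add_zero, if_true, neg_mul_neg]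
    at n0 n1 n2 n3 o02 o13
  have hc : rowForm S ψ₂ = q₁ * q₆ * e * S 2 3 := by
    rw [hψ₂, rowForm_shifted_schmidt]
    ring
  have hb : rowPolar S ψ₁ ψ₂ = q₁ * q₆ * (e * S 0 3 - S 1 2) := by
    rw [hψ₁, hψ₂, rowPolar_schmidt_shifted_schmidt, hsk 1 2]
    ring
  have ha : rowForm S ψ₁ = q₁ * q₆ * S 0 1 := rowForm_schmidt S q₁ q₆
  -- In this combination of the four row norms all other entries cancel, leaving 2(|S₀₁|² - |S₂₃|²)
  -- = 0.
  have hn : S 0 1 * star (S 0 1) = S 2 3 * star (S 2 3) := by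
    linear_combination (n0 + n1 - n2 - n3) / 2
  obtain ⟨α, β, hαβ, hz1, hz2⟩ := exists_isotropic_pair (a := rowForm S ψ₁)
    (b := rowPolar S ψ₁ ψ₂ / 2) (c := rowForm S ψ₂)
    (by
      rw [← Complex.ofReal_inj, ← Complex.mul_conj, ← Complex.mul_conj, ha, hc]
      simp only [map_mul, Complex.conj_ofReal]
      simp only [Complex.star_def] at hn hee
      linear_combination (q₁ : ℂ) ^ 2 * (q₆ : ℂ) ^ 2 * hn -
        (q₁ : ℂ) ^ 2 * (q₆ : ℂ) ^ 2 * (S 2 3 * (starRingEnd ℂ) (S 2 3)) * hee)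
    (by
      have h2 : star (2 : ℂ) = 2 := by simp
      have hq : ∀ q : ℝ, star (q : ℂ) = q := fun q => by simp
      rw [star_div₀, h2, ha, hc, hb]
      simp only [star_mul', star_sub, hq]
      linear_combination ((q₁ : ℂ) * q₆) ^ 2 / 2 * (star e * o13 + o02) +
        ((q₁ : ℂ) * q₆) ^ 2 / 2 * S 0 3 * star (S 2 3) * hee)
  have m11 : inner ℂ ψ₁ ψ₁ = (1 : ℂ) := (norm_eq_one_iff_inner _).1 h.spectral.norm_fst
  have m22 : inner ℂ ψ₂ ψ₂ = (1 : ℂ) := (norm_eq_one_iff_inner _).1 h.spectral.norm_snd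
  have m12 : inner ℂ ψ₁ ψ₂ = (0 : ℂ) := h.spectral.orthogonal
  have m21 : inner ℂ ψ₂ ψ₁ = (0 : ℂ) := inner_eq_zero_symm.1 m12
  have hmix : ρ = ((1 / 2 : ℝ) : ℂ) • ketBra ψ₁ + ((1 - 1 / 2 : ℝ) : ℂ) • ketBra ψ₂ :=
    h.spectral.eq_mix
  have hαβ' : α * star α + β * star β = 1 := by
    rw [Complex.star_def, Complex.mul_conj, Complex.mul_conj]
    exact_mod_cast hαβ
  have hnorm : ∀ z w : ℂ, z * star z + w * star w = 1 → ‖z • ψ₁ + w • ψ₂‖ = 1 := fun z w hzw => by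
    rw [norm_eq_one_iff_inner]
    simp only [inner_add_left, inner_add_right, inner_smul_left, inner_smul_right, m11, m22, m12,
      m21]
    simp only [Complex.star_def] at hzw
    linear_combination hzw
  refine ⟨2, ![1 / 2, 1 / 2], ![α • ψ₁ + β • ψ₂, star β • ψ₁ + (-star α) • ψ₂],
    ⟨fun j => ?_, ?_, fun j => ?_, ?_⟩, fun j => ?_⟩
  · fin_cases j <;> norm_num
  · norm_num
  · fin_cases j
    · exact hnorm _ _ hαβ'
    · refine hnorm _ _ ?_
      rw [star_neg, star_star, star_star]
      linear_combination hαβ'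
  · rw [hmix, Fin.sum_univ_two]
    ext p q
    simp only [Matrix.add_apply, Matrix.smul_apply, ketBra, Matrix.of_apply, smul_eq_mul,
      Matrix.cons_val_zero, Matrix.cons_val_one, PiLp.add_apply, PiLp.smul_apply, star_add,
      star_mul', star_neg, star_star]
    push_cast
    linear_combination (-(1 / 2 : ℂ) * (ψ₁ p * star (ψ₁ q) + ψ₂ p * star (ψ₂ q))) * hαβ'
  · fin_cases j
    · simp only [Fin.zero_eta, Matrix.cons_val_zero]
      rw [rowForm_add, ← hz1]
      ring
    · simp only [Fin.mk_one, Matrix.cons_val_one, Matrix.cons_val_zero]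
      rw [rowForm_add, ← hz2]
      ring

/-- An ensemble of a separable state would put a product vector zψ₁ + wψ₂ in the range. Its minor on
b₁, b₂ is z²q₁q₆ and that on b₃, b₄ is w²q₁q₆e; both must vanish, so the vector is zero. -/
theorem not_isSeparable_of_canonical {lam : ℝ} {e : ℂ} (he0 : e ≠ 0)
    (h : IsCanonicalForm lam q₁ q₆
      ((q₁ : ℂ) • basisKet 0 2 + ((q₆ : ℂ) * e) • basisKet 1 3) ρ) :
    ¬ IsSeparable ρ := by
  intro hs
  obtain ⟨N, μ, φ, he, hp⟩ := isSeparable_iff.1 hs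
  have hN : N ≠ 0 := by
    rintro rfl
    simpa using he.sum_eq_one
  obtain ⟨j⟩ : Nonempty (Fin N) := ⟨⟨0, Nat.pos_of_ne_zero hN⟩⟩
  obtain ⟨a, b, hab⟩ := hp j
  have hr := he.eq_add_of_isSpectralForm h.spectral j
  set z : ℂ := inner ℂ ((q₁ : ℂ) • basisKet 0 0 + (q₆ : ℂ) • basisKet 1 1) (φ j)
  set w : ℂ := inner ℂ ((q₁ : ℂ) • basisKet 0 2 + ((q₆ : ℂ) * e) • basisKet 1 3) (φ j)
  have hq1 : (q₁ : ℂ) ≠ 0 := by exact_mod_cast h.q₁_pos.ne'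
  have hq6 : (q₆ : ℂ) ≠ 0 := by exact_mod_cast h.q₆_pos.ne'
  have hval : ∀ p, a p.1 * b p.2 = z * ((q₁ : ℂ) • basisKet 0 0 + (q₆ : ℂ) • basisKet 1 1) p +
      w * ((q₁ : ℂ) • basisKet 0 2 + ((q₆ : ℂ) * e) • basisKet 1 3) p := fun p => by
    have := congrArg (fun ψ : Ket (Fin 2 × Fin 4) => ψ p) (hab.symm.trans hr)
    exact this
  simp only [schmidt_apply, shifted_schmidt_apply] at hval
  have v00 := hval (0, 0)
  have v11 := hval (1, 1)
  have v01 := hval (0, 1)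
  have v10 := hval (1, 0)
  have v02 := hval (0, 2)
  have v13 := hval (1, 3)
  have v03 := hval (0, 3)
  simp at v00 v11 v01 v10 v02 v13 v03
  have hz : z = 0 := by
    have : z ^ 2 * (q₁ * q₆) = 0 := by
      have h0 : (a 0 * b 1) * (a 1 * b 0) = 0 := by rcases v01 with h | h <;> simp [h]
      calc z ^ 2 * (q₁ * q₆) = (a 0 * b 0) * (a 1 * b 1) := by rw [v00, v11]; ring
        _ = (a 0 * b 1) * (a 1 * b 0) := by ring
        _ = 0 := h0
    simpa [hq1, hq6] using this
  have hw : w = 0 := by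
    have : w ^ 2 * (q₁ * q₆ * e) = 0 := by
      have h0 : (a 0 * b 3) * (a 1 * b 2) = 0 := by rcases v03 with h | h <;> simp [h]
      calc w ^ 2 * (q₁ * q₆ * e) = (a 0 * b 2) * (a 1 * b 3) := by rw [v02, v13]; ring
        _ = (a 0 * b 3) * (a 1 * b 2) := by ring
        _ = 0 := h0
    simpa [hq1, hq6, he0] using this
  have hn := he.norm_eq_one j
  rw [hr, hz, hw] at hn
  simp at hn

end ZCE

/-! ### Two-qubit states inside ℂ² ⊗ ℂ⁴ -/

section QubitBlock

theorem isProductKet_of_det_eq_zero {χ : Ket (Fin 2 × Fin 2)}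
    (h : χ (0, 0) * χ (1, 1) = χ (0, 1) * χ (1, 0)) : IsProductKet χ := by
  by_cases h0 : χ (0, 0) = 0
  · by_cases h1 : χ (0, 1) = 0
    · refine ⟨!₂[0, 1], !₂[χ (1, 0), χ (1, 1)], ?_⟩
      ext ⟨i, j⟩
      fin_cases i <;> fin_cases j <;> simp [prodKet, h0, h1]
    · refine ⟨!₂[1, χ (1, 1) / χ (0, 1)], !₂[χ (0, 0), χ (0, 1)], ?_⟩
      have h2 : χ (1, 0) = 0 := by simpa [h0, h1] using h
      ext ⟨i, j⟩
      fin_cases i <;> fin_cases j <;> simp [prodKet, h0, h1, h2]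
  · refine ⟨!₂[1, χ (1, 0) / χ (0, 0)], !₂[χ (0, 0), χ (0, 1)], ?_⟩
    ext ⟨i, j⟩
    fin_cases i <;> fin_cases j <;> simp [prodKet, h0]
    field_simp
    linear_combination h

/-- The inclusion of `ℂ²` into `ℂ⁴` as the span of the first two basis vectors. -/
def qubitInclusion : Matrix (Fin 4) (Fin 2) ℂ := !![1, 0; 0, 1; 0, 0; 0, 0]

theorem qubitInclusion_isometry : qubitInclusionᴴ * qubitInclusion = 1 := by
  ext i j
  fin_cases i <;> fin_cases j <;> simp [qubitInclusion, Matrix.mul_apply, Fin.sum_univ_four]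

theorem IsQubitBlockForm.eq_embed {ρ : Matrix (Fin 2 × Fin 4) (Fin 2 × Fin 4) ℂ}
    (h : IsQubitBlockForm ρ) :
    ρ = ((1 : Matrix (Fin 2) (Fin 2) ℂ) ⊗ₖ qubitInclusion) * qubitBlock ρ *
      ((1 : Matrix (Fin 2) (Fin 2) ℂ) ⊗ₖ qubitInclusion)ᴴ := by
  have hval : ∀ i j k l, (((1 : Matrix (Fin 2) (Fin 2) ℂ) ⊗ₖ qubitInclusion) * qubitBlock ρ *
      ((1 : Matrix (Fin 2) (Fin 2) ℂ) ⊗ₖ qubitInclusion)ᴴ) (i, j) (k, l) =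
      ∑ a, ∑ b, qubitInclusion j a * qubitBlock ρ (i, a) (k, b) * star (qubitInclusion l b) :=
    fun i j k l => by
      rw [Finset.sum_comm]
      fin_cases i <;> fin_cases k <;>
        simp [Matrix.mul_apply, Fintype.sum_prod_type, Fin.sum_univ_two (M := ℂ)] <;> ring
  have hc2 : ∀ p k, ρ p (k, 2) = 0 := fun p k => h.col_zero p k 2 (by decide)
  have hc3 : ∀ p k, ρ p (k, 3) = 0 := fun p k => h.col_zero p k 3 (by decide)
  have hr2 : ∀ i q, ρ (i, 2) q = 0 := fun i q => h.row_zero i 2 q (by decide)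
  have hr3 : ∀ i q, ρ (i, 3) q = 0 := fun i q => h.row_zero i 3 q (by decide)
  ext ⟨i, j⟩ ⟨k, l⟩
  rw [hval]
  simp only [Fin.sum_univ_two]
  fin_cases j <;> fin_cases l <;>
    simp [qubitInclusion, qubitBlock, hc2, hc3, hr2, hr3]

theorem IsQubitBlockForm.isSeparable {ρ : Matrix (Fin 2 × Fin 4) (Fin 2 × Fin 4) ℂ}
    (h : IsQubitBlockForm ρ) : IsSeparable ρ := by
  rw [h.eq_embed]
  exact h.block_separable.map (by simp) qubitInclusion_isometry

/-- The restriction of a vector to the first two basis vectors of the second factor. -/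
def qubitRestrict (φ : Ket (Fin 2 × Fin 4)) : Ket (Fin 2 × Fin 2) :=
  WithLp.toLp 2 fun p => φ (p.1, Fin.castLE (by norm_num) p.2)

theorem norm_qubitRestrict {φ : Ket (Fin 2 × Fin 4)} (h2 : ∀ i, φ (i, 2) = 0)
    (h3 : ∀ i, φ (i, 3) = 0) : ‖qubitRestrict φ‖ = ‖φ‖ := by
  rw [EuclideanSpace.norm_eq, EuclideanSpace.norm_eq]
  congr 1
  simp [Fintype.sum_prod_type, Fin.sum_univ_four, h2, h3, qubitRestrict]

/-- On vectors supported on b₁, b₂ the form `skewMat 1 0 0` is the 2 × 2 determinant, whose zeros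
are the product vectors. -/
theorem isSeparable_qubitBlock {ρ : Matrix (Fin 2 × Fin 4) (Fin 2 × Fin 4) ℂ} {N : ℕ}
    {μ : Fin N → ℝ} {φ : Fin N → Ket (Fin 2 × Fin 4)} (he : IsEnsemble μ φ ρ)
    (h2 : ∀ j i, φ j (i, 2) = 0) (h3 : ∀ j i, φ j (i, 3) = 0)
    (hS : ∀ j, rowForm (skewMat 1 0 0) (φ j) = 0) : IsSeparable (qubitBlock ρ) := by
  refine isSeparable_iff.2 ⟨N, μ, fun j => qubitRestrict (φ j), ⟨he.pos, he.sum_eq_one,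
    fun j => ?_, ?_⟩, fun j => isProductKet_of_det_eq_zero ?_⟩
  · rw [norm_qubitRestrict (h2 j) (h3 j), he.norm_eq_one]
  · rw [he.eq_sum]
    ext p q
    simp [qubitBlock, Matrix.sum_apply, ketBra, qubitRestrict]
  · have := hS j
    rw [rowForm_skewMat] at this
    simp only [h2, h3] at this
    simp at this
    exact sub_eq_zero.1 this

end QubitBlock

/-! ### Sufficiency, disjointness and an entangled example -/

section Classes

theorem isCanonicalForm_of_shifted {ρ : Matrix (Fin 2 × Fin 4) (Fin 2 × Fin 4) ℂ}
    {lam q₁ q₆ : ℝ} {r₁ r₆ : ℂ} (hs : IsSpectralForm lam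
      ((q₁ : ℂ) • basisKet 0 0 + (q₆ : ℂ) • basisKet 1 1) (r₁ • basisKet 0 2 + r₆ • basisKet 1 3) ρ)
    (h₁ : 0 < q₁) (h₆ : 0 < q₆) :
    IsCanonicalForm lam q₁ q₆ (r₁ • basisKet 0 2 + r₆ • basisKet 1 3) ρ := by
  have v00 : (r₁ • basisKet 0 2 + r₆ • basisKet 1 3) (0, 0) = 0 := by
    simp [shifted_schmidt_apply, -PiLp.add_apply, -WithLp.ofLp_add]
  have v11 : (r₁ • basisKet 0 2 + r₆ • basisKet 1 3) (1, 1) = 0 := by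
    simp [shifted_schmidt_apply, -PiLp.add_apply, -WithLp.ofLp_add]
  have v03 : (r₁ • basisKet 0 2 + r₆ • basisKet 1 3) (0, 3) = 0 := by
    simp [shifted_schmidt_apply, -PiLp.add_apply, -WithLp.ofLp_add]
  refine ⟨hs, h₁, h₆, ?_, ?_, ?_, ?_, v03, ?_⟩
  · rw [v00, Complex.zero_re]
  · rw [v00, Complex.zero_im]
  · rw [v11, Complex.zero_re]
  · rw [v11, Complex.zero_im]
  · rw [v00, v11, zero_mul, zero_mul, add_zero]

variable {ρ : Matrix (Fin 2 × Fin 4) (Fin 2 × Fin 4) ℂ}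

theorem IsZCS.isSeparable (h : IsZCS ρ) : IsSeparable ρ := by
  rcases h with ⟨lam, ψ₁, ψ₂, hs, h1, h2⟩ | ⟨-, X, hX, Y, hY, lam, q₁, q₆, ψ₂, -, hb⟩
  · refine isSeparable_iff.2 ⟨2, _, _, hs.isEnsemble, fun j => ?_⟩
    fin_cases j
    · exact h1
    · exact h2
  · have hX' := (Matrix.mem_specialUnitaryGroup_iff.1 hX).1
    have hY' := (Matrix.mem_specialUnitaryGroup_iff.1 hY).1
    rw [← localTransform_star_self hX' hY' ρ, localTransform_eq]
    exact hb.isSeparable.map (Matrix.mem_unitaryGroup_iff'.1 (Unitary.star_mem hX'))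
      (Matrix.mem_unitaryGroup_iff'.1 (Unitary.star_mem hY'))

/-- The two rows of a product vector are proportional, so every skew form vanishes on it and one
separable ensemble serves all S. -/
theorem IsSeparable.isZC (h : IsSeparable ρ) : IsZC ρ := by
  refine isZC_iff.2 fun S hS _ => ?_
  obtain ⟨N, μ, φ, he, hp⟩ := isSeparable_iff.1 h
  refine ⟨N, μ, φ, he, fun j => ?_⟩
  obtain ⟨a, b, hab⟩ := hp j
  have hsk : ∀ i j, S j i = -S i j := fun i j => congrFun (congrFun hS i) j
  refine self_eq_neg.1 ?_
  rw [hab, rowForm]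
  conv_lhs => rw [Finset.sum_comm]
  simp only [← Finset.sum_neg_distrib, prodKet]
  refine Finset.sum_congr rfl fun k _ => Finset.sum_congr rfl fun l _ => ?_
  rw [hsk k l]
  ring

theorem IsZCE.isZC (h : IsZCE ρ) : IsZC ρ := by
  obtain ⟨X, hX, Y, hY, q₁, q₆, φ, hc⟩ := h
  have hX' := (Matrix.mem_specialUnitaryGroup_iff.1 hX).1
  have hY' := (Matrix.mem_specialUnitaryGroup_iff.1 hY).1
  rw [← localTransform_star_self hX' hY' ρ, localTransform_eq, isZC_iff]
  exact (rowIsotropic_of_canonical hc).map (Unitary.star_mem hX') (Unitary.star_mem hY')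

theorem IsZCE.not_isSeparable (h : IsZCE ρ) : ¬ IsSeparable ρ := by
  obtain ⟨X, hX, Y, hY, q₁, q₆, φ, hc⟩ := h
  have hX' := (Matrix.mem_specialUnitaryGroup_iff.1 hX).1
  have hY' := (Matrix.mem_specialUnitaryGroup_iff.1 hY).1
  refine fun hs => not_isSeparable_of_canonical (Complex.exp_ne_zero _) hc ?_
  rw [localTransform_eq]
  exact hs.map (Matrix.mem_unitaryGroup_iff'.1 hX') (Matrix.mem_unitaryGroup_iff'.1 hY')

/-- An entangled state of rank two all of whose generalized concurrences vanish. -/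
theorem exists_isZCE : ∃ ρ : Matrix (Fin 2 × Fin 4) (Fin 2 × Fin 4) ℂ,
    IsState ρ ∧ ρ.rank = 2 ∧ IsZCE ρ := by
  set q : ℝ := (Real.sqrt 2)⁻¹ with hq
  have hq0 : 0 < q := inv_pos.2 (Real.sqrt_pos.2 two_pos)
  have hqq : (q : ℂ) * q = 1 / 2 := by
    have : q * q = 1 / 2 := by
      rw [hq, ← mul_inv, Real.mul_self_sqrt two_pos.le, one_div]
    rw [← Complex.ofReal_mul, this]
    simp
  set ψ₁ : Ket (Fin 2 × Fin 4) := (q : ℂ) • basisKet 0 0 + (q : ℂ) • basisKet 1 1 with hψ₁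
  set ψ₂ : Ket (Fin 2 × Fin 4) := (q : ℂ) • basisKet 0 2 +
    ((q : ℂ) * Complex.exp (Complex.I * (0 : ℝ))) • basisKet 1 3 with hψ₂
  have hv2 : ∀ p, ψ₂ p = if p = (0, 2) then (q : ℂ) else if p = (1, 3) then (q : ℂ) else 0 :=
    fun p => by
      rw [hψ₂, shifted_schmidt_apply]
      simp
  have hv1 : ∀ p, ψ₁ p = if p = (0, 0) then (q : ℂ) else if p = (1, 1) then (q : ℂ) else 0 :=
    fun p => by
      rw [hψ₁, schmidt_apply]
  have hs : IsSpectralForm (1 / 2) ψ₁ ψ₂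
      (((1 / 2 : ℝ) : ℂ) • ketBra ψ₁ + ((1 - 1 / 2 : ℝ) : ℂ) • ketBra ψ₂) := by
    refine ⟨by norm_num, by norm_num, ?_, ?_, ?_, rfl⟩
    · rw [norm_eq_one_iff_inner, inner_eq_sum]
      simp only [hv1]
      simp [Fintype.sum_prod_type, Fin.sum_univ_four, hqq]
      norm_num
    · rw [norm_eq_one_iff_inner, inner_eq_sum]
      simp only [hv2]
      simp [Fintype.sum_prod_type, Fin.sum_univ_four, hqq]
      norm_num
    · rw [inner_eq_sum]
      simp only [hv1, hv2]
      simp [Fintype.sum_prod_type, Fin.sum_univ_four]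
  refine ⟨_, hs.isEnsemble.isState, hs.rank_eq_two, 1, one_mem _, 1, one_mem _, q, q, 0, ?_⟩
  have h1 : ∀ σ, localTransform 1 1 σ = σ := fun σ => by simp [localTransform]
  rw [h1]
  exact isCanonicalForm_of_shifted hs hq0 hq0

end Classes

/-! ### Necessity: support of the second eigenvector -/

section Forward

variable {ρ : Matrix (Fin 2 × Fin 4) (Fin 2 × Fin 4) ℂ}

theorem IsRowIsotropic.exists_ensemble_skewMat (h : IsRowIsotropic ρ) {s t u : ℂ}
    (hpos : 0 < Complex.normSq s + Complex.normSq t + Complex.normSq u) :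
    ∃ (N : ℕ) (μ : Fin N → ℝ) (φ : Fin N → Ket (Fin 2 × Fin 4)),
      IsEnsemble μ φ ρ ∧ ∀ j, rowForm (skewMat s t u) (φ j) = 0 :=
  h.of_smul (skewMat_transpose s t u) hpos (skewMat_mul_conjTranspose s t u)

/-- The dichotomy for a real-linear form `z ↦ m z + n z̄` of constant modulus on the circle. -/
theorem eq_zero_or_eq_zero_of_normSq {m n : ℂ} {K : ℝ}
    (h1 : Complex.normSq (m + n) = K) (h2 : Complex.normSq (Complex.I * m - Complex.I * n) = K)
    (h3 : Complex.normSq ((1 + Complex.I) * m + (1 - Complex.I) * n) = 2 * K) :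
    m = 0 ∨ n = 0 := by
  have key : Complex.normSq m * Complex.normSq n =
      (m.re * n.re + m.im * n.im) ^ 2 + (m.im * n.re - m.re * n.im) ^ 2 := by
    simp only [Complex.normSq_apply]
    ring
  simp only [Complex.normSq_apply, Complex.add_re, Complex.add_im, Complex.sub_re, Complex.sub_im,
    Complex.mul_re, Complex.mul_im, Complex.one_re, Complex.one_im, Complex.I_re,
    Complex.I_im] at h1 h2 h3
  -- The points z = 1 and z = i give Re(m n̄) = 0; then z = 1 + i gives Im(m n̄) = 0.
  have ha : m.re * n.re + m.im * n.im = 0 := by linarith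
  have hb : m.im * n.re - m.re * n.im = 0 := by linarith
  rw [ha, hb] at key
  have : Complex.normSq m * Complex.normSq n = 0 := by rw [key]; ring
  simpa using this

/-- The position of the second eigenvector relative to the Schmidt decomposition of the first. -/
theorem IsRowIsotropic.support_dichotomy {lam q₁ q₆ : ℝ} {ψ : Ket (Fin 2 × Fin 4)}
    (h : IsRowIsotropic ρ) (hq₁ : 0 < q₁) (hq₆ : 0 < q₆)
    (hs : IsSpectralForm lam ((q₁ : ℂ) • basisKet 0 0 + (q₆ : ℂ) • basisKet 1 1) ψ ρ) :
    (∀ i, ψ (i, 2) = 0 ∧ ψ (i, 3) = 0) ∨ (∀ i, ψ (i, 0) = 0 ∧ ψ (i, 1) = 0) := by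
  have hl0 := hs.lam_pos
  have hl1 : 0 < 1 - lam := sub_pos.2 hs.lam_lt_one
  have rel : ∀ s t u : ℂ, 0 < Complex.normSq s + Complex.normSq t + Complex.normSq u →
      lam ^ 2 * Complex.normSq (q₁ * q₆ * s) =
        (1 - lam) ^ 2 * Complex.normSq (rowForm (skewMat s t u) ψ) := fun s t u hp => by
    obtain ⟨N, μ, φ, he, h0⟩ := h.exists_ensemble_skewMat hp
    have := (he.rowForm_relations hs h0).1
    rwa [rowForm_schmidt, show skewMat s t u 0 1 = s from rfl] at this
  -- For s = 0 the form vanishes on the first eigenvector, so the modulus relation forces it to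
  -- vanish on the second.
  have rel0 : ∀ t u : ℂ, 0 < Complex.normSq t + Complex.normSq u →
      rowForm (skewMat 0 t u) ψ = 0 := fun t u hp => by
    have := rel 0 t u (by simpa using hp)
    rw [mul_zero, map_zero, mul_zero] at this
    simpa [hl1.ne'] using this.symm
  set x : Fin 4 → ℂ := fun i => ψ (0, i) with hx
  set y : Fin 4 → ℂ := fun i => ψ (1, i) with hy
  have r1 := rel0 1 0 (by simp)
  have r2 := rel0 Complex.I 0 (by simp)
  have r3 := rel0 0 1 (by simp)
  have r4 := rel0 0 Complex.I (by simp)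
  rw [rowForm_skewMat] at r1 r2 r3 r4
  simp only [star_zero, star_one, Complex.star_def, Complex.conj_I, zero_mul, one_mul, add_zero,
    zero_add, sub_zero] at r1 r2 r3 r4
  change (x 0 * y 2 - x 2 * y 0) - (x 1 * y 3 - x 3 * y 1) = 0 at r1
  change Complex.I * (x 0 * y 2 - x 2 * y 0) - -Complex.I * (x 1 * y 3 - x 3 * y 1) = 0 at r2
  change (x 0 * y 3 - x 3 * y 0) + (x 1 * y 2 - x 2 * y 1) = 0 at r3
  change Complex.I * (x 0 * y 3 - x 3 * y 0) + -Complex.I * (x 1 * y 2 - x 2 * y 1) = 0 at r4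
  have I2 := Complex.I_mul_I
  -- Comparing the parameters 1 and i separates the part linear in t (or u) from the
  -- conjugate-linear part, so each mixed minor vanishes by itself.
  have m02 : x 0 * y 2 - x 2 * y 0 = 0 := by
    linear_combination r1 / 2 - Complex.I / 2 * r2 +
      ((x 0 * y 2 - x 2 * y 0) + (x 1 * y 3 - x 3 * y 1)) / 2 * I2
  have m13 : x 1 * y 3 - x 3 * y 1 = 0 := by linear_combination m02 - r1
  have m03 : x 0 * y 3 - x 3 * y 0 = 0 := by
    linear_combination r3 / 2 - Complex.I / 2 * r4 +
      ((x 0 * y 3 - x 3 * y 0) - (x 1 * y 2 - x 2 * y 1)) / 2 * I2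
  have m12 : x 1 * y 2 - x 2 * y 1 = 0 := by linear_combination r3 - m03
  set m := x 0 * y 1 - x 1 * y 0 with hm
  set n := x 2 * y 3 - x 3 * y 2 with hn
  have hrel : ∀ s : ℂ, 0 < Complex.normSq s → lam ^ 2 * Complex.normSq (q₁ * q₆ * s) =
      (1 - lam) ^ 2 * Complex.normSq (s * m + star s * n) := fun s hp => by
    have := rel s 0 0 (by simpa using hp)
    rw [rowForm_skewMat] at this
    simpa using this
  set K : ℝ := lam ^ 2 * (q₁ * q₁ * (q₆ * q₆)) / (1 - lam) ^ 2 with hK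
  have hK0 : 0 < K := by positivity
  have hrel' : ∀ s : ℂ, 0 < Complex.normSq s →
      Complex.normSq (s * m + star s * n) = Complex.normSq s * K := fun s hp => by
    have := hrel s hp
    rw [Complex.normSq_mul, Complex.normSq_mul, Complex.normSq_ofReal, Complex.normSq_ofReal] at this
    rw [hK]
    field_simp
    linarith
  have e1 := hrel' 1 (by simp)
  have e2 := hrel' Complex.I (by simp)
  have e3 := hrel' (1 + Complex.I) (by norm_num [Complex.normSq_apply])
  have hmn : m = 0 ∨ n = 0 := by
    refine eq_zero_or_eq_zero_of_normSq (K := K) ?_ ?_ ?_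
    · simpa using e1
    · simpa [sub_eq_add_neg] using e2
    · have h2 : Complex.normSq (1 + Complex.I) = 2 := by norm_num [Complex.normSq_apply]
      rw [h2] at e3
      simpa [sub_eq_add_neg] using e3
  have hne : ¬ (m = 0 ∧ n = 0) := by
    rintro ⟨h1, h2⟩
    rw [h1, h2] at e1
    simp at e1
    exact hK0.ne e1
  rcases hmn with h0 | h0
  · right
    have hn0 : n ≠ 0 := fun h2 => hne ⟨h0, h2⟩
    -- This and its analogues expand a 3 × 3 determinant with a repeated row x or y; all minors but
    -- n are known to vanish.
    have c1 : x 0 * n = 0 := by rw [hn]; linear_combination x 2 * m03 - x 3 * m02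
    have c2 : x 1 * n = 0 := by rw [hn]; linear_combination x 2 * m13 - x 3 * m12
    have c3 : y 0 * n = 0 := by rw [hn]; linear_combination y 2 * m03 - y 3 * m02
    have c4 : y 1 * n = 0 := by rw [hn]; linear_combination y 2 * m13 - y 3 * m12
    intro i
    fin_cases i
    · exact ⟨(mul_eq_zero.1 c1).resolve_right hn0, (mul_eq_zero.1 c2).resolve_right hn0⟩
    · exact ⟨(mul_eq_zero.1 c3).resolve_right hn0, (mul_eq_zero.1 c4).resolve_right hn0⟩
  · left
    have hm0 : m ≠ 0 := fun h2 => hne ⟨h2, h0⟩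
    have c1 : x 2 * m = 0 := by rw [hm]; linear_combination x 1 * m02 - x 0 * m12
    have c2 : x 3 * m = 0 := by rw [hm]; linear_combination x 1 * m03 - x 0 * m13
    have c3 : y 2 * m = 0 := by rw [hm]; linear_combination y 1 * m02 - y 0 * m12
    have c4 : y 3 * m = 0 := by rw [hm]; linear_combination y 1 * m03 - y 0 * m13
    intro i
    fin_cases i
    · exact ⟨(mul_eq_zero.1 c1).resolve_right hm0, (mul_eq_zero.1 c2).resolve_right hm0⟩
    · exact ⟨(mul_eq_zero.1 c3).resolve_right hm0, (mul_eq_zero.1 c4).resolve_right hm0⟩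

/-- If the second eigenvector has the same `B`-support as the first one, the state is a separable
two qubit state. -/
theorem IsRowIsotropic.isQubitBlockForm {lam q₁ q₆ : ℝ} {ψ : Ket (Fin 2 × Fin 4)}
    (h : IsRowIsotropic ρ)
    (hs : IsSpectralForm lam ((q₁ : ℂ) • basisKet 0 0 + (q₆ : ℂ) • basisKet 1 1) ψ ρ)
    (h0 : ∀ i, ψ (i, 2) = 0 ∧ ψ (i, 3) = 0) : IsQubitBlockForm ρ := by
  have hψ : ∀ (i : Fin 2) (j : Fin 4), 2 ≤ j.val →
      ((q₁ : ℂ) • basisKet 0 0 + (q₆ : ℂ) • basisKet 1 1) (i, j) = 0 ∧ ψ (i, j) = 0 := by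
    intro i j hj
    rw [schmidt_apply]
    fin_cases j
    · simp at hj
    · simp at hj
    · exact ⟨by simp, (h0 i).1⟩
    · exact ⟨by simp, (h0 i).2⟩
  refine ⟨fun i j q hj => ?_, fun p i j hj => ?_, ?_⟩
  · rw [hs.eq_mix]
    simp only [Matrix.add_apply, Matrix.smul_apply, ketBra, Matrix.of_apply, (hψ i j hj).1,
      (hψ i j hj).2, zero_mul, smul_zero, add_zero]
  · rw [hs.eq_mix]
    simp only [Matrix.add_apply, Matrix.smul_apply, ketBra, Matrix.of_apply, (hψ i j hj).1,
      (hψ i j hj).2, star_zero, mul_zero, smul_zero, add_zero]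
  · obtain ⟨N, μ, φ, he, hφ⟩ := h.exists_ensemble_skewMat (s := 1) (t := 0) (u := 0) (by simp)
    have hval : ∀ j (i : Fin 2) (k : Fin 4), 2 ≤ k.val → φ j (i, k) = 0 := fun j i k hk => by
      have := congrArg (fun χ : Ket (Fin 2 × Fin 4) => χ (i, k)) (he.eq_add_of_isSpectralForm hs j)
      refine this.trans ?_
      rw [PiLp.add_apply, PiLp.smul_apply, PiLp.smul_apply, (hψ i k hk).1, (hψ i k hk).2, smul_zero,
        smul_zero, add_zero]
    exact isSeparable_qubitBlock he (fun j i => hval j i 2 (by decide))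
      (fun j i => hval j i 3 (by decide)) hφ

end Forward

/-! ### Necessity: orthogonal supports, and conclusion -/

section Forward

variable {ρ : Matrix (Fin 2 × Fin 4) (Fin 2 × Fin 4) ℂ}

/-- The unitary of `ℂ⁴` that acts on the span of the last two basis vectors by the unitary with
first row `(x̄, ȳ)`. -/
def lowerRotation (x y : ℂ) : Matrix (Fin 4) (Fin 4) ℂ :=
  !![1, 0, 0, 0; 0, 1, 0, 0; 0, 0, star x, star y; 0, 0, -y, x]

theorem lowerRotation_mem {x y : ℂ} (h : x * star x + y * star y = 1) :
    lowerRotation x y ∈ Matrix.unitaryGroup (Fin 4) ℂ := by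
  rw [Matrix.mem_unitaryGroup_iff]
  simp only [Complex.star_def] at h
  ext i j
  fin_cases i <;> fin_cases j <;>
    simp [lowerRotation, Matrix.mul_apply, Fin.sum_univ_four, Matrix.star_eq_conjTranspose] <;>
    first
    | linear_combination h
    | ring

theorem mulKet_lowerRotation (x y : ℂ) (ψ : Ket (Fin 2 × Fin 4)) (i : Fin 2) (j : Fin 4) :
    mulKet ((1 : Matrix (Fin 2) (Fin 2) ℂ) ⊗ₖ lowerRotation x y) ψ (i, j) =
      ![ψ (i, 0), ψ (i, 1), star x * ψ (i, 2) + star y * ψ (i, 3),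
        -y * ψ (i, 2) + x * ψ (i, 3)] j := by
  rw [mulKet_apply, Fintype.sum_prod_type]
  fin_cases i <;> fin_cases j <;>
    simp [lowerRotation, Fin.sum_univ_four]

/-- The second eigenvector when its `B`-support is orthogonal to that of the first one. -/
theorem IsRowIsotropic.lower_coordinates {lam q₁ q₆ : ℝ} {ψ : Ket (Fin 2 × Fin 4)}
    (h : IsRowIsotropic ρ) (hq₁ : 0 < q₁) (hq₆ : 0 < q₆)
    (hs : IsSpectralForm lam ((q₁ : ℂ) • basisKet 0 0 + (q₆ : ℂ) • basisKet 1 1) ψ ρ)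
    (h0 : ∀ i, ψ (i, 0) = 0 ∧ ψ (i, 1) = 0) :
    lam = 1 / 2 ∧ ψ (0, 2) * star (ψ (0, 2)) + ψ (0, 3) * star (ψ (0, 3)) = (q₁ : ℂ) ^ 2 ∧
    ∃ m : ℂ, Complex.normSq m = (q₁ * q₆) ^ 2 ∧
      (q₁ : ℂ) ^ 2 * ψ (1, 2) = -(star (ψ (0, 3)) * m) ∧
      (q₁ : ℂ) ^ 2 * ψ (1, 3) = star (ψ (0, 2)) * m := by
  have hl0 := hs.lam_pos
  have hl1 : 0 < 1 - lam := sub_pos.2 hs.lam_lt_one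
  set x2 := ψ (0, 2) with hx2
  set x3 := ψ (0, 3) with hx3
  set y2 := ψ (1, 2) with hy2
  set y3 := ψ (1, 3) with hy3
  set m := x2 * y3 - x3 * y2 with hm
  have h00 := (h0 0).1
  have h01 := (h0 0).2
  have h10 := (h0 1).1
  have h11 := (h0 1).2
  have rel : ∀ s t u : ℂ, 0 < Complex.normSq s + Complex.normSq t + Complex.normSq u →
      lam ^ 2 * Complex.normSq (q₁ * q₆ * s) = (1 - lam) ^ 2 * Complex.normSq (star s * m) ∧
      lam * (q₁ * q₆ * s) * star (q₁ * (t * y2 + u * y3) + q₆ * (-star u * x2 + star t * x3)) +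
        ((1 - lam : ℝ) : ℂ) * (q₁ * (t * y2 + u * y3) + q₆ * (-star u * x2 + star t * x3)) *
          star (star s * m) = 0 := fun s t u hp => by
    obtain ⟨N, μ, φ, he, hφ⟩ := h.exists_ensemble_skewMat hp
    have hr := he.rowForm_relations hs hφ
    have e1 : rowForm (skewMat s t u) ψ = star s * m := by
      rw [rowForm_skewMat, h00, h01, h10, h11]
      ring
    have e2 : rowPolar (skewMat s t u) ((q₁ : ℂ) • basisKet 0 0 + (q₆ : ℂ) • basisKet 1 1) ψ =
        q₁ * (t * y2 + u * y3) + q₆ * (-star u * x2 + star t * x3) := by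
      rw [rowPolar_schmidt]
      simp [skewMat, Fin.sum_univ_four, h00, h01, h10, h11, hx2, hx3, hy2, hy3]
    rwa [rowForm_schmidt, show skewMat s t u 0 1 = s from rfl, e1, e2] at hr
  have n1 := (rel 1 0 0 (by simp)).1
  have p1 := (rel 1 1 0 (by simp)).2
  have p2 := (rel 1 Complex.I 0 (by simp)).2
  have p3 := (rel 1 0 1 (by simp)).2
  have p4 := (rel 1 0 Complex.I (by simp)).2
  simp only [star_one, star_zero, mul_one, one_mul, zero_mul, neg_zero, add_zero, zero_add,
    Complex.star_def, Complex.conj_I, map_add, map_mul, map_neg, Complex.conj_ofReal,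
    Complex.normSq_ofReal, map_one] at n1 p1 p2 p3 p4
  have I2 := Complex.I_mul_I
  set k : ℂ := ((1 - lam : ℝ) : ℂ) with hk
  have hk0 : k ≠ 0 := Complex.ofReal_ne_zero.2 hl1.ne'
  have hl : (lam : ℂ) ≠ 0 := by exact_mod_cast hl0.ne'
  have hq1 : (q₁ : ℂ) ≠ 0 := by exact_mod_cast hq₁.ne'
  have hq6 : (q₆ : ℂ) ≠ 0 := by exact_mod_cast hq₆.ne'
  -- The t-linear part of the off-diagonal relation at s = 1, extracted from t = 1 and t = i; `E2`
  -- does the same for u.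
  have E1 : k * q₁ * y2 * star m = -(lam * (q₁ * q₆) * q₆ * star x3) := by
    simp only [Complex.star_def]
    linear_combination p1 / 2 - Complex.I / 2 * p2 + (-(lam * (q₁ * q₆) *
      (q₁ * (starRingEnd ℂ) y2 - q₆ * (starRingEnd ℂ) x3)) +
      k * (q₁ * y2 - q₆ * x3) * (starRingEnd ℂ) m) / 2 * I2
  have E2 : k * q₁ * y3 * star m = lam * (q₁ * q₆) * q₆ * star x2 := by
    simp only [Complex.star_def]
    linear_combination p3 / 2 - Complex.I / 2 * p4 + (-(lam * (q₁ * q₆) *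
      (q₁ * (starRingEnd ℂ) y3 + q₆ * (starRingEnd ℂ) x2)) +
      k * (q₁ * y3 + q₆ * x2) * (starRingEnd ℂ) m) / 2 * I2
  have E1' : k * q₁ * star y2 * m = -(lam * (q₁ * q₆) * q₆ * x3) := by
    simpa [hk] using congrArg star E1
  have E2' : k * q₁ * star y3 * m = lam * (q₁ * q₆) * q₆ * x2 := by
    simpa [hk] using congrArg star E2
  have hmm : k ^ 2 * (m * star m) = lam ^ 2 * (q₁ * q₆) ^ 2 := by
    rw [Complex.star_def, Complex.mul_conj, hk, ← Complex.ofReal_pow, ← Complex.ofReal_mul, ← n1]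
    push_cast
    ring
  set P := x2 * star x2 + x3 * star x3 with hP
  set R := y2 * star y2 + y3 * star y3 with hR
  -- P and R are the squared norms of the two rows of ψ. This identity, R : P = q₆² : q₁² and the
  -- normalizations P + R = 1 = q₁² + q₆² give P = q₁² and then lam = 1 - lam.
  have hkP : lam * (q₁ : ℂ) ^ 2 = k * P := by
    refine mul_left_cancel₀ (mul_ne_zero (mul_ne_zero hl (mul_ne_zero hq1 hq6)) hq6) ?_
    linear_combination -(q₁ : ℂ) * hmm + k * x2 * E2 - k * x3 * E1 + k ^ 2 * q₁ * star m * hm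
  have hPR : (q₁ : ℂ) ^ 2 * R = (q₆ : ℂ) ^ 2 * P := by
    refine mul_left_cancel₀ (pow_ne_zero 2 (mul_ne_zero hl (mul_ne_zero hq1 hq6))) ?_
    linear_combination -(q₁ : ℂ) ^ 2 * R * hmm + k * q₁ * star y2 * m * E1 +
      k * q₁ * star y3 * m * E2 - (lam * (q₁ * q₆) * q₆ * star x3) * E1' +
      lam * (q₁ * q₆) * q₆ * star x2 * E2'
  have hsum : P + R = 1 := by
    rw [← (norm_eq_one_iff_inner _).1 hs.norm_snd, inner_eq_sum]
    simp [Fintype.sum_prod_type, Fin.sum_univ_four, h00, h01, h10, h11, hP, hR, hx2, hx3, hy2, hy3]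
    ring
  have hqsum : (q₁ : ℂ) ^ 2 + (q₆ : ℂ) ^ 2 = 1 := by
    rw [← (norm_eq_one_iff_inner _).1 hs.norm_fst, inner_eq_sum]
    simp only [schmidt_apply]
    simp [Fintype.sum_prod_type, Fin.sum_univ_four]
    ring
  have hPq : P = (q₁ : ℂ) ^ 2 := by
    linear_combination (q₁ : ℂ) ^ 2 * hsum - hPR - P * hqsum
  have hlk : (lam : ℂ) = k := by
    rw [hPq] at hkP
    exact mul_right_cancel₀ (pow_ne_zero 2 hq1) hkP
  have hlam : lam = 1 - lam := Complex.ofReal_injective hlk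
  rw [← hlk] at hmm E1 E2
  have hmm' : m * star m = (q₁ * q₆) ^ 2 := mul_left_cancel₀ (pow_ne_zero 2 hl) hmm
  refine ⟨by linarith, hPq, m, ?_, ?_, ?_⟩
  · rw [Complex.star_def, Complex.mul_conj] at hmm'
    exact_mod_cast hmm'
  · refine mul_left_cancel₀ (mul_ne_zero hl (mul_ne_zero hq1 (pow_ne_zero 2 hq6))) ?_
    linear_combination m * E1 - lam * q₁ * y2 * hmm'
  · refine mul_left_cancel₀ (mul_ne_zero hl (mul_ne_zero hq1 (pow_ne_zero 2 hq6))) ?_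
    linear_combination m * E2 - lam * q₁ * y3 * hmm'

/-- The class `ZCE` arises when the two eigenvectors have orthogonal `B`-supports. -/
theorem IsRowIsotropic.exists_canonicalForm {lam q₁ q₆ : ℝ} {ψ : Ket (Fin 2 × Fin 4)}
    (h : IsRowIsotropic ρ) (hq₁ : 0 < q₁) (hq₆ : 0 < q₆)
    (hs : IsSpectralForm lam ((q₁ : ℂ) • basisKet 0 0 + (q₆ : ℂ) • basisKet 1 1) ψ ρ)
    (h0 : ∀ i, ψ (i, 0) = 0 ∧ ψ (i, 1) = 0) :
    ∃ Y ∈ Matrix.unitaryGroup (Fin 4) ℂ, ∃ φ : ℝ, IsCanonicalForm (1 / 2) q₁ q₆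
      ((q₁ : ℂ) • basisKet 0 2 + ((q₆ : ℂ) * Complex.exp (Complex.I * φ)) • basisKet 1 3)
      (localTransform 1 Y ρ) := by
  obtain ⟨rfl, hxx, m, hm, hy2, hy3⟩ := h.lower_coordinates hq₁ hq₆ hs h0
  have hq : (q₁ : ℂ) ≠ 0 := by exact_mod_cast hq₁.ne'
  -- This unitary sends the first row of ψ to (q₁, 0) in the b₃, b₄ plane. The second row then
  -- becomes (0, m / q₁) with |m| = q₁q₆, so the angle φ is the argument of m.
  have hY : lowerRotation (ψ (0, 2) / q₁) (ψ (0, 3) / q₁) ∈ Matrix.unitaryGroup (Fin 4) ℂ := by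
    refine lowerRotation_mem ?_
    simp only [star_div₀, Complex.star_def, Complex.conj_ofReal] at hxx ⊢
    field_simp
    linear_combination hxx
  have hmarg : m = q₁ * q₆ * Complex.exp (Complex.I * m.arg) := by
    have : ‖m‖ = q₁ * q₆ := by
      rw [Complex.normSq_eq_norm_sq] at hm
      exact (pow_left_inj₀ (norm_nonneg _) (by positivity) two_ne_zero).1 hm
    conv_lhs => rw [← Complex.norm_mul_exp_arg_mul_I m, this]
    rw [mul_comm Complex.I]
    push_cast
    rfl
  refine ⟨_, hY, m.arg, isCanonicalForm_of_shifted ?_ hq₁ hq₆⟩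
  set U := (1 : Matrix (Fin 2) (Fin 2) ℂ) ⊗ₖ lowerRotation (ψ (0, 2) / q₁) (ψ (0, 3) / q₁) with hU
  have hUiso : Uᴴ * U = 1 :=
    kronecker_isometry (by simp) (Matrix.mem_unitaryGroup_iff'.1 hY)
  have hs' := hs.map hUiso
  rw [← localTransform_eq] at hs'
  have e1 : mulKet U ((q₁ : ℂ) • basisKet 0 0 + (q₆ : ℂ) • basisKet 1 1) =
      (q₁ : ℂ) • basisKet 0 0 + (q₆ : ℂ) • basisKet 1 1 := by
    ext ⟨i, j⟩
    rw [mulKet_lowerRotation]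
    simp only [schmidt_apply]
    fin_cases i <;> fin_cases j <;> simp
  have e2 : mulKet U ψ = (q₁ : ℂ) • basisKet 0 2 +
      ((q₆ : ℂ) * Complex.exp (Complex.I * m.arg)) • basisKet 1 3 := by
    ext ⟨i, j⟩
    rw [mulKet_lowerRotation, shifted_schmidt_apply]
    fin_cases i <;> fin_cases j
    · simpa using (h0 0).1
    · simpa using (h0 0).2
    · simp only [Complex.star_def] at hxx
      simp
      field_simp
      linear_combination hxx
    · simp
      ring
    · simpa using (h0 1).1
    · simpa using (h0 1).2
    · simp only [Complex.star_def] at hy2 hy3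
      simp
      field_simp
      refine mul_left_cancel₀ (pow_ne_zero 2 hq) ?_
      linear_combination (starRingEnd ℂ) (ψ (0, 2)) * hy2 + (starRingEnd ℂ) (ψ (0, 3)) * hy3
    · simp only [Complex.star_def] at hy2 hy3 hxx
      simp
      field_simp
      refine mul_left_cancel₀ (pow_ne_zero 2 hq) ?_
      linear_combination -ψ (0, 3) * hy2 + ψ (0, 2) * hy3 + m * hxx + (q₁ : ℂ) ^ 2 * hmarg
  rwa [e1, e2] at hs'

/-- The phase of the second eigenvector is free, so p₁ can be made nonnegative. Orthogonality to the
first eigenvector then makes p₆ real and nonpositive, and the support condition gives p₄ = 0. -/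
theorem exists_phase_canonical {lam q₁ q₆ : ℝ} {ψ : Ket (Fin 2 × Fin 4)} (hq₁ : 0 < q₁)
    (hq₆ : 0 < q₆)
    (hs : IsSpectralForm lam ((q₁ : ℂ) • basisKet 0 0 + (q₆ : ℂ) • basisKet 1 1) ψ ρ)
    (h0 : ∀ i, ψ (i, 2) = 0 ∧ ψ (i, 3) = 0) :
    ∃ ψ' : Ket (Fin 2 × Fin 4), IsCanonicalForm lam q₁ q₆ ψ' ρ := by
  obtain ⟨c, hc, hcz⟩ := RCLike.exists_norm_eq_mul_self (ψ (0, 0))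
  have hs' := hs.smul_snd hc
  have v0 : (c • ψ) (0, 0) = (‖ψ (0, 0)‖ : ℂ) := hcz.symm
  have horth : (c • ψ) (0, 0) * (q₁ : ℂ) + (c • ψ) (1, 1) * (q₆ : ℂ) = 0 := by
    have := hs'.orthogonal
    rw [inner_eq_sum] at this
    simp only [schmidt_apply] at this
    rw [← this]
    simp [Fintype.sum_prod_type, Fin.sum_univ_four]
    ring
  have hq : (q₆ : ℂ) ≠ 0 := by exact_mod_cast hq₆.ne'
  have v1 : (c • ψ) (1, 1) = ((-(‖ψ (0, 0)‖ * q₁ / q₆) : ℝ) : ℂ) := by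
    rw [v0] at horth
    push_cast
    field_simp
    linear_combination horth
  refine ⟨c • ψ, hs', hq₁, hq₆, ?_, ?_, ?_, ?_, ?_, horth⟩
  · rw [v0, Complex.ofReal_re]
    exact norm_nonneg _
  · rw [v0, Complex.ofReal_im]
  · rw [v1, Complex.ofReal_re]
    exact neg_nonpos.2 (by positivity)
  · rw [v1, Complex.ofReal_im]
  · rw [PiLp.smul_apply, (h0 0).2, smul_zero]

theorem IsZC.isZCS_or_isZCE_of_not_isProductKet {lam : ℝ} {ψ₁ ψ₂ : Ket (Fin 2 × Fin 4)}
    (h : IsZC ρ) (hs : IsSpectralForm lam ψ₁ ψ₂ ρ) (hψ : ¬ IsProductKet ψ₁) :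
    IsZCS ρ ∨ IsZCE ρ := by
  obtain ⟨X, hX, Y, hY, q₁, q₆, hq₁, hq₆, he⟩ := exists_schmidt hψ
  have hX1 : Xᴴ * X = 1 := Matrix.mem_unitaryGroup_iff'.1 hX
  have hY1 : Yᴴ * Y = 1 := Matrix.mem_unitaryGroup_iff'.1 hY
  have hs' := hs.map (kronecker_isometry hX1 hY1)
  have hi := (isZC_iff.1 h).map hX hY
  rw [he] at hs'
  rw [← localTransform_eq] at hs' hi
  rcases hi.support_dichotomy hq₁ hq₆ hs' with h0 | h0
  · left
    right
    have hb := hi.isQubitBlockForm hs' h0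
    obtain ⟨ψ', hc⟩ := exists_phase_canonical hq₁ hq₆ hs' h0
    obtain ⟨X', hX', Y', hY', hXY⟩ := exists_specialUnitary_localTransform hX hY
    refine ⟨?_, X', hX', Y', hY', lam, q₁, q₆, ψ', ?_, ?_⟩
    · refine IsSeparable.isPPT ?_
      rw [← localTransform_star_self hX hY ρ, localTransform_eq]
      exact hb.isSeparable.map (Matrix.mem_unitaryGroup_iff'.1 (Unitary.star_mem hX))
        (Matrix.mem_unitaryGroup_iff'.1 (Unitary.star_mem hY))
    · rwa [hXY]
    · rwa [hXY]
  · right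
    obtain ⟨Z, hZ, φ, hc⟩ := hi.exists_canonicalForm hq₁ hq₆ hs' h0
    rw [localTransform_localTransform, one_mul] at hc
    obtain ⟨X', hX', Y', hY', hXY⟩ := exists_specialUnitary_localTransform hX (mul_mem hZ hY)
    refine ⟨X', hX', Y', hY', q₁, q₆, φ, ?_⟩
    rwa [hXY]

theorem IsZC.isZCS_or_isZCE (h : IsZC ρ) (hρ : IsState ρ) (hr : ρ.rank = 2) :
    IsZCS ρ ∨ IsZCE ρ := by
  obtain ⟨lam, ψ₁, ψ₂, hs⟩ := hρ.exists_isSpectralForm hr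
  by_cases h1 : IsProductKet ψ₁
  · by_cases h2 : IsProductKet ψ₂
    · exact Or.inl (Or.inl ⟨lam, ψ₁, ψ₂, hs, h1, h2⟩)
    -- The eigenvalues are not ordered, so whichever eigenvector is entangled may be taken as the
    -- first.
    · exact h.isZCS_or_isZCE_of_not_isProductKet hs.swap h2
  · exact h.isZCS_or_isZCE_of_not_isProductKet hs h1

end Forward

end Concurrence

end

theorem theorem3p2 :
    (∀ ρ : Matrix (Fin 2 × Fin 4) (Fin 2 × Fin 4) ℂ,
      Concurrence.IsState ρ → ρ.rank = 2 →
        ((Concurrence.IsZC ρ ↔ (Concurrence.IsZCS ρ ∨ Concurrence.IsZCE ρ)) ∧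
          ¬ (Concurrence.IsZCS ρ ∧ Concurrence.IsZCE ρ) ∧
          (Concurrence.IsZCS ρ → Concurrence.IsSeparable ρ) ∧
          (Concurrence.IsZCE ρ → ¬ Concurrence.IsSeparable ρ))) ∧
    (∃ ρ : Matrix (Fin 2 × Fin 4) (Fin 2 × Fin 4) ℂ,
      Concurrence.IsState ρ ∧ ρ.rank = 2 ∧ Concurrence.IsZC ρ ∧
        ¬ Concurrence.IsSeparable ρ) := by
  refine ⟨fun ρ hρ hr => ⟨⟨fun h => h.isZCS_or_isZCE hρ hr, ?_⟩,
    fun h => h.2.not_isSeparable h.1.isSeparable, fun h => h.isSeparable,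
    fun h => h.not_isSeparable⟩, ?_⟩
  · rintro (h | h)
    · exact h.isSeparable.isZC
    · exact h.isZC
  · obtain ⟨ρ, hρ, hr, h⟩ := Concurrence.exists_isZCE
    exact ⟨ρ, hρ, hr, h.isZC, h.not_isSeparable⟩
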